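/- Let $d\ge 1$ be an integer. Let $\mathbb S^{d}\subset\mathbb R^{d+1}$ be the $d$-dimensional unit sphere with its surface measure, let $\mathcal H_n^d$ be the space of spherical harmonics of degree $n$ on $\mathbb S^d$ (the restrictions to $\mathbb S^d$ of the complex homogeneous harmonic polynomials of degree $n$ in $d+1$ variables), and let $H_n^d$ be the orthogonal projection of $L^2(\mathbb S^d)$ onto $\mathcal H_n^d$, extended to $f\in L^1(\mathbb S^d)$ by $H_n^d f=\sum_i \big(\int_{\mathbb S^d} f\,\overline{Y_i}\,d\sigma\big)\,Y_i$ for an orthonormal basis $(Y_i)$ of $\mathcal H_n^d$. For $p,q\in[1,\infty]$ put $$\|H_n^d\|_{p,q}:=\sup_{\|f\|_{L^p(\mathbb S^d)}\le 1}\|H_n^d f\|_{L^q(\mathbb S^d)} .$$ Let $p,q\in[1,\infty]$. There is a constant $C$, depending only on $d,p,q$, such that the following holds. Suppose that $B\ge 0$ satisfies $$\|H_n^d\|_{p,q}\le B\,n^{d(\frac1p-\frac1q)-1}\qquad\text{for all integers } n\ge 1 .$$ Then, for every Schwartz function $f\in\mathcal S(\mathbb R^d)$, $$\Big\|\int_{\mathbb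 S^{d-1}}e^{ix\cdot\eta}\,\widehat f(\eta)\,d\sigma(\eta)\Big\|_{L^q(\mathbb R^d)}\le C\,B\,\|f\|_{L^p(\mathbb R^d)},$$ where the $L^q$ norm is taken in the variable $x$, $\widehat f(\eta)=\int_{\mathbb R^d}e^{-iy\cdot\eta}f(y)\,dy$, and $\sigma$ is the surface measure on the unit sphere $\mathbb S^{d-1}\subset\mathbb R^d$ (counting measure on $\{\pm1\}$ if $d=1$). -/

import Mathlib

open MeasureTheory

namespace SphericalProjection

/-- The Euclidean space `ℝ^m`. -/
abbrev Euc (m : ℕ) : Type := EuclideanSpace ℝ (Fin m)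

/-- The unit sphere centred at the origin of `ℝ^m`, i.e. the sphere of dimension `m - 1`. -/
abbrev UnitSphere (m : ℕ) : Type := Metric.sphere (0 : Euc m) 1

/-- The (unnormalized) surface measure on the unit sphere of `ℝ^m`. -/
noncomputable abbrev sphereMeasure (m : ℕ) : Measure (UnitSphere m) :=
  (volume : Measure (Euc m)).toSphere

/-- The Laplacian `∑ i, ∂²/∂x_i²` on complex polynomials in `m` variables. -/
noncomputable def laplacian (m : ℕ) :
    MvPolynomial (Fin m) ℂ →ₗ[ℂ] MvPolynomial (Fin m) ℂ :=
  ∑ i, (MvPolynomial.pderiv i).toLinearMap ∘ₗ (MvPolynomial.pderiv i).toLinearMap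

/-- The homogeneous harmonic polynomials of degree `n` in `m` variables. -/
noncomputable def harmonicPolynomials (m n : ℕ) : Submodule ℂ (MvPolynomial (Fin m) ℂ) :=
  MvPolynomial.homogeneousSubmodule (Fin m) ℂ n ⊓ LinearMap.ker (laplacian m)

/-- The `i`-th coordinate as a complex-valued continuous function on the unit sphere. -/
noncomputable def coordinate (m : ℕ) (i : Fin m) : C(UnitSphere m, ℂ) where
  toFun x := ((x : Euc m) i : ℂ)
  continuous_toFun := by fun_prop

/-- Restriction of polynomials to the unit sphere, as continuous functions. -/
noncomputable def restrictToSphere (m : ℕ) :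
    MvPolynomial (Fin m) ℂ →ₗ[ℂ] C(UnitSphere m, ℂ) :=
  (MvPolynomial.aeval (coordinate m)).toLinearMap

theorem restrictToSphere_apply (m : ℕ) (P : MvPolynomial (Fin m) ℂ) (x : UnitSphere m) :
    restrictToSphere m P x = MvPolynomial.eval (fun i => ((x : Euc m) i : ℂ)) P := by
  induction P using MvPolynomial.induction_on with
  | C a => simp [restrictToSphere]
  | add P Q hP hQ => simp only [map_add, ContinuousMap.add_apply, hP, hQ]
  | mul_X P i hP =>
    simp only [restrictToSphere, AlgHom.toLinearMap_apply] at hP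
    simp [restrictToSphere, hP, coordinate]

/-- The space of spherical harmonics of degree `n` on the `d`-dimensional unit sphere of
`ℝ^(d+1)`: the restrictions to the sphere of the homogeneous harmonic polynomials of degree `n`,
as a subspace of `L²` of the sphere. -/
noncomputable def sphericalHarmonics (d n : ℕ) :
    Submodule ℂ (Lp ℂ 2 (sphereMeasure (d + 1))) :=
  (harmonicPolynomials (d + 1) n).map
    ((ContinuousMap.toLp (E := ℂ) 2 (sphereMeasure (d + 1)) ℂ).toLinearMap ∘ₗ
      restrictToSphere (d + 1))

instance (d n : ℕ) : FiniteDimensional ℂ (sphericalHarmonics d n) := by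
  have h : FiniteDimensional ℂ (harmonicPolynomials (d + 1) n) := by
    have h1 : harmonicPolynomials (d + 1) n ≤
        MvPolynomial.restrictTotalDegree (Fin (d + 1)) ℂ n := by
      intro P hP
      rw [MvPolynomial.mem_restrictTotalDegree]
      exact ((MvPolynomial.mem_homogeneousSubmodule n P).1 hP.1).totalDegree_le
    exact Submodule.finiteDimensional_of_le h1
  unfold sphericalHarmonics
  infer_instance

/-- The projection `H_n^d f` of a function `f` on the `d`-dimensional unit sphere to the spherical
harmonics of degree `n`, namely `∑ i, ⟨f, Y_i⟩ Y_i` for an orthonormal basis `Y_i` of that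
finite-dimensional space; since the `Y_i` are bounded it makes sense for every integrable `f`. -/
noncomputable def harmonicProj (d n : ℕ) (f : UnitSphere (d + 1) → ℂ) :
    Lp ℂ 2 (sphereMeasure (d + 1)) :=
  let Y := stdOrthonormalBasis ℂ (sphericalHarmonics d n)
  ∑ i, (∫ x, f x * star ((Y i : Lp ℂ 2 (sphereMeasure (d + 1))) x) ∂sphereMeasure (d + 1)) •
    (Y i : Lp ℂ 2 (sphereMeasure (d + 1)))

/-- On `L²`, `harmonicProj` is the orthogonal projection to the spherical harmonics. -/
theorem harmonicProj_eq_starProjection (d n : ℕ) (f : Lp ℂ 2 (sphereMeasure (d + 1))) :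
    harmonicProj d n f = (sphericalHarmonics d n).starProjection f := by
  rw [(stdOrthonormalBasis ℂ (sphericalHarmonics d n)).starProjection_eq_sum_rankOne]
  simp only [harmonicProj, FunLike.coe_sum, Finset.sum_apply,
    InnerProductSpace.rankOne_apply, L2.inner_def, RCLike.inner_apply]
  rfl

theorem harmonicProj_mem (d n : ℕ) (f : UnitSphere (d + 1) → ℂ) :
    harmonicProj d n f ∈ sphericalHarmonics d n :=
  Submodule.sum_mem _ fun _ _ => Submodule.smul_mem _ _ (Subtype.mem _)

/-- Pairing an integrable function with a spherical harmonic gives an integrable function. -/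
theorem integrable_mul_star_of_mem (d n : ℕ) {f : UnitSphere (d + 1) → ℂ}
    (hf : Integrable f (sphereMeasure (d + 1))) {g : Lp ℂ 2 (sphereMeasure (d + 1))}
    (hg : g ∈ sphericalHarmonics d n) :
    Integrable (fun x => f x * star (g x)) (sphereMeasure (d + 1)) := by
  obtain ⟨P, -, rfl⟩ := hg
  have h1 := ContinuousMap.coeFn_toLp (p := 2) (𝕜 := ℂ) (sphereMeasure (d + 1))
    (restrictToSphere (d + 1) P)
  have h2 : Integrable (fun x => f x * star (restrictToSphere (d + 1) P x))
      (sphereMeasure (d + 1)) := by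
    refine hf.mul_bdd (c := ‖restrictToSphere (d + 1) P‖) ?_ ?_
    · exact (continuous_star.comp
        (restrictToSphere (d + 1) P).continuous).aestronglyMeasurable
    · exact Filter.Eventually.of_forall fun x => by
        rw [norm_star]; exact ContinuousMap.norm_coe_le_norm _ x
  refine h2.congr ?_
  filter_upwards [h1] with x hx
  simp only [LinearMap.comp_apply]
  exact congrArg (fun z => f x * star z) hx.symm

theorem integral_mul_star_sum {m : ℕ} {ι : Type*} [Fintype ι] {f : UnitSphere m → ℂ}
    (Y : ι → Lp ℂ 2 (sphereMeasure m)) (c : ι → ℂ)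
    (hY : ∀ i, Integrable (fun x => f x * star (Y i x)) (sphereMeasure m)) :
    ∫ x, f x * star ((∑ i, c i • Y i : Lp ℂ 2 (sphereMeasure m)) x) ∂sphereMeasure m =
      ∑ i, star (c i) * ∫ x, f x * star (Y i x) ∂sphereMeasure m := by
  have hc : ∀ᵐ x ∂sphereMeasure m,
      f x * star ((∑ i, c i • Y i : Lp ℂ 2 (sphereMeasure m)) x) =
        ∑ i, star (c i) * (f x * star (Y i x)) := by
    have h2 : ∀ᵐ x ∂sphereMeasure m, ∀ i,
        (c i • Y i : Lp ℂ 2 (sphereMeasure m)) x = c i * Y i x :=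
      ae_all_iff.2 fun i => Lp.coeFn_smul _ _
    filter_upwards [Lp.coeFn_finsetSum Finset.univ (fun i => c i • Y i), h2] with x h1 h2
    rw [h1, Finset.sum_apply, star_sum, Finset.mul_sum]
    refine Finset.sum_congr rfl fun i _ => ?_
    rw [h2, star_mul]
    ring
  rw [integral_congr_ae hc, integral_finsetSum _ fun i _ => (hY i).const_mul (star (c i))]
  exact Finset.sum_congr rfl fun i _ => integral_const_mul _ _

/-- For integrable `f`, `harmonicProj d n f` is the spherical harmonic of degree `n` that has the
same pairing as `f` with every spherical harmonic of degree `n`. -/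
theorem inner_harmonicProj (d n : ℕ) {f : UnitSphere (d + 1) → ℂ}
    (hf : Integrable f (sphereMeasure (d + 1))) {g : Lp ℂ 2 (sphereMeasure (d + 1))}
    (hg : g ∈ sphericalHarmonics d n) :
    inner ℂ g (harmonicProj d n f) = ∫ x, f x * star (g x) ∂sphereMeasure (d + 1) := by
  have h1 := integral_mul_star_sum (f := f)
    (fun i => (stdOrthonormalBasis ℂ (sphericalHarmonics d n) i :
      Lp ℂ 2 (sphereMeasure (d + 1))))
    (fun i => inner ℂ (stdOrthonormalBasis ℂ (sphericalHarmonics d n) i :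
      Lp ℂ 2 (sphereMeasure (d + 1))) g)
    (fun i => integrable_mul_star_of_mem d n hf (Subtype.mem _))
  have h2 := congrArg (Submodule.subtype _)
    ((stdOrthonormalBasis ℂ (sphericalHarmonics d n)).sum_repr' ⟨g, hg⟩)
  simp only [map_sum, map_smul, Submodule.subtype_apply, Submodule.coe_inner] at h2
  rw [h2] at h1
  rw [h1]
  unfold harmonicProj
  rw [inner_sum]
  refine Finset.sum_congr rfl fun i _ => ?_
  rw [inner_smul_right, mul_comm]
  congr 1
  exact (inner_conj_symm _ _).symm

/-- The `L^p`-`L^q` operator norm of `H_n^d`, with values in `[0, ∞]`. -/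
noncomputable def projNorm (d n : ℕ) (p q : ENNReal) : ENNReal :=
  ⨆ (f : UnitSphere (d + 1) → ℂ) (_ : MemLp f p (sphereMeasure (d + 1)))
    (_ : eLpNorm f p (sphereMeasure (d + 1)) ≤ 1),
    eLpNorm (harmonicProj d n f) q (sphereMeasure (d + 1))

/-- The Fourier transform `∫ e^{-i y·η} f(y) dy`. -/
noncomputable def fourierHat {d : ℕ} (f : Euc d → ℂ) (η : Euc d) : ℂ :=
  ∫ y, Complex.exp (-Complex.I * (inner ℝ y η : ℝ)) * f y

/-- The function `x ↦ ∫ e^{i x·η} f^(η) dσ(η)`, the integral being over the unit sphere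
of `ℝ^d`. -/
noncomputable def sphereExtension {d : ℕ} (f : Euc d → ℂ) (x : Euc d) : ℂ :=
  ∫ η : UnitSphere d, Complex.exp (Complex.I * (inner ℝ x (η : Euc d) : ℝ)) *
    fourierHat f (η : Euc d) ∂sphereMeasure d

end SphericalProjection

/-! At scale `1/n` around the pole the sphere looks like `ℝ^d`, and the projection of degree `n`
looks like convolution with the Fourier transform of the surface measure of `S^(d-1)`, which is the
extension operator (`sphereExtension_eq`). The assumed bounds are transplanted to `ℝ^d`, and `n`
tends to infinity.

The kernel of the projection is zonal: a constant `κ_n` times `Z_n(x·y)`, where `Z_n(t) = ∫ (t +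
i√(1-t²) η₀)^n dσ(η)` over `S^(d-1)`. This Laplace representation (`integral_slice_eq`) rests on the
fact that a homogeneous harmonic polynomial vanishing at the pole has mean zero over every parallel
(`integral_slice_eq_zero`); the argument treats `d = 1` like all other dimensions. It shows at once
that `|Z_n| ≤ σ(S^(d-1))` and that, at the cosine of an angle asymptotic to `|x-y|/n`, `Z_n` tends
to `∫ e^{i(x-y)·η} dσ(η)` (`tendsto_zonal_scaledInner`). A trace identity and a dimension count give
`|κ_n| ≥ c n^(d-1)` for `n ≥ 2` (`exists_le_norm_kernelDiag`).

Central projection carries `f(n·)`, cut off to the unit ball, to the sphere, at the cost of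
constants independent of `n` (`eLpNorm_scaledProj_le`). The input contributes `n^(-d/p)`, the output
`n^(-d/q)`, and the kernel `κ_n n^(-d)`, at least of order `n⁻¹`. Against the assumed growth
`n^(d(1/p-1/q)-1)` all powers of `n` cancel (`exists_eLpNorm_scaledProj_le`). The localized
operators converge pointwise to the extension of `f` (`tendsto_scaledProj`), and Fatou's lemma in
`L^q` finishes the proof. -/

namespace SphericalProjection

/-! ### Polynomials as functions on real space -/

/-- The value of a complex polynomial at a real point. -/
noncomputable def realEval {m : ℕ} (P : MvPolynomial (Fin m) ℂ) (x : Euc m) : ℂ :=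
  MvPolynomial.eval (fun i => (x i : ℂ)) P

section realEval

variable {m : ℕ}

@[simp] theorem realEval_C (a : ℂ) (x : Euc m) : realEval (MvPolynomial.C a) x = a := by
  simp [realEval]

@[simp] theorem realEval_X (i : Fin m) (x : Euc m) : realEval (MvPolynomial.X i) x = x i := by
  simp [realEval]

@[simp] theorem realEval_zero (x : Euc m) : realEval 0 x = 0 := by
  simp [realEval]

@[simp] theorem realEval_one (x : Euc m) : realEval 1 x = 1 := by
  simp [realEval]

@[simp] theorem realEval_add (P Q : MvPolynomial (Fin m) ℂ) (x : Euc m) :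
    realEval (P + Q) x = realEval P x + realEval Q x := by
  simp [realEval]

@[simp] theorem realEval_sub (P Q : MvPolynomial (Fin m) ℂ) (x : Euc m) :
    realEval (P - Q) x = realEval P x - realEval Q x := by
  simp [realEval]

@[simp] theorem realEval_mul (P Q : MvPolynomial (Fin m) ℂ) (x : Euc m) :
    realEval (P * Q) x = realEval P x * realEval Q x := by
  simp [realEval]

@[simp] theorem realEval_smul (a : ℂ) (P : MvPolynomial (Fin m) ℂ) (x : Euc m) :
    realEval (a • P) x = a * realEval P x := by
  simp [realEval]

@[simp] theorem realEval_pow (P : MvPolynomial (Fin m) ℂ) (n : ℕ) (x : Euc m) :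
    realEval (P ^ n) x = realEval P x ^ n := by
  simp [realEval]

@[simp] theorem realEval_sum {ι : Type*} (s : Finset ι) (P : ι → MvPolynomial (Fin m) ℂ)
    (x : Euc m) : realEval (∑ i ∈ s, P i) x = ∑ i ∈ s, realEval (P i) x := by
  simp [realEval]

theorem realEval_homogeneous_smul {P : MvPolynomial (Fin m) ℂ} {k : ℕ} (hP : P.IsHomogeneous k)
    (r : ℝ) (x : Euc m) : realEval P (r • x) = (r : ℂ) ^ k * realEval P x := by
  unfold realEval
  rw [MvPolynomial.eval_eq', MvPolynomial.eval_eq', Finset.mul_sum]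
  refine Finset.sum_congr rfl fun s hs => ?_
  have h : ∑ i, s i = k := by
    by_contra hne
    exact MvPolynomial.mem_support_iff.1 hs (hP.coeff_eq_zero (by rwa [Finsupp.degree_eq_sum]))
  have h2 : ∏ i, (((r • x : Euc m) i : ℝ) : ℂ) ^ s i = (r : ℂ) ^ k * ∏ i, (x i : ℂ) ^ s i := by
    rw [← h, ← Finset.prod_pow_eq_pow_sum, ← Finset.prod_mul_distrib]
    exact Finset.prod_congr rfl fun i _ => by simp [mul_pow]
  rw [h2]
  ring

theorem continuous_realEval (P : MvPolynomial (Fin m) ℂ) : Continuous (realEval P) := by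
  unfold realEval
  exact (MvPolynomial.continuous_eval P).comp (by fun_prop)

theorem hasLineDerivAt_realEval (P : MvPolynomial (Fin m) ℂ) (i : Fin m) (x : Euc m) :
    HasLineDerivAt ℝ (realEval P) (realEval (MvPolynomial.pderiv i P) x) x
      (EuclideanSpace.single i 1) := by
  unfold HasLineDerivAt
  induction P using MvPolynomial.induction_on with
  | C a => simpa using hasDerivAt_const (0 : ℝ) a
  | add P Q hP hQ =>
    simp only [map_add, realEval_add]
    exact hP.add hQ
  | mul_X P j hP =>
    have h : HasDerivAt (fun t : ℝ => (((x + t • EuclideanSpace.single i (1 : ℝ)) j : ℝ) : ℂ))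
        ((if i = j then 1 else 0 : ℂ)) 0 := by
      have h1 : HasDerivAt (fun t : ℝ => x j + t * (if i = j then 1 else 0 : ℝ))
          (if i = j then 1 else 0 : ℝ) 0 := by
        simpa using ((hasDerivAt_id (0 : ℝ)).mul_const (if i = j then 1 else 0 : ℝ)).const_add (x j)
      convert! h1.ofReal_comp using 1
      · ext t; simp [eq_comm]
      · split_ifs <;> simp
    have h3 := hP.mul h
    simp only [realEval_mul, realEval_X, MvPolynomial.pderiv_mul, realEval_add,
      MvPolynomial.pderiv_X]
    convert! h3 using 1
    by_cases hij : i = j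
    · subst hij; simp
    · simp [hij]

/-- An exponential bound is stable under sums and under multiplication by a variable, so no degree
has to be tracked, and a Gaussian still absorbs it. -/
theorem exists_norm_realEval_le (P : MvPolynomial (Fin m) ℂ) :
    ∃ C k : ℝ, 0 ≤ C ∧ 0 ≤ k ∧ ∀ x, ‖realEval P x‖ ≤ C * Real.exp (k * ‖x‖) := by
  induction P using MvPolynomial.induction_on with
  | C a => exact ⟨‖a‖, 0, norm_nonneg _, le_rfl, fun x => by simp⟩
  | add P Q hP hQ =>
    obtain ⟨C, k, hC, hk, h⟩ := hP
    obtain ⟨C', k', hC', hk', h'⟩ := hQ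
    refine ⟨C + C', k + k', by positivity, by positivity, fun x => ?_⟩
    have h1 : Real.exp (k * ‖x‖) ≤ Real.exp ((k + k') * ‖x‖) := by gcongr; linarith
    have h2 : Real.exp (k' * ‖x‖) ≤ Real.exp ((k + k') * ‖x‖) := by gcongr; linarith
    rw [realEval_add, add_mul]
    refine (norm_add_le _ _).trans (add_le_add ((h x).trans ?_) ((h' x).trans ?_)) <;> gcongr
  | mul_X P j hP =>
    obtain ⟨C, k, hC, hk, h⟩ := hP
    refine ⟨C, k + 1, by positivity, by positivity, fun x => ?_⟩
    have h1 : ‖((x j : ℝ) : ℂ)‖ ≤ Real.exp ‖x‖ := by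
      rw [Complex.norm_real]
      exact (PiLp.norm_apply_le x j).trans ((Real.add_one_le_exp ‖x‖).trans' (by linarith))
    rw [realEval_mul, realEval_X, norm_mul, add_mul, one_mul, Real.exp_add, ← mul_assoc]
    gcongr
    exact h x

end realEval

/-! ### Gaussian integrals of polynomials -/

/-- The Gaussian weight `exp (-‖x‖² / 2)`. -/
noncomputable def gaussianWeight {d : ℕ} (x : Euc d) : ℂ := (Real.exp (-(‖x‖ ^ 2 / 2)) : ℝ)

section gaussian

variable {d : ℕ}

theorem continuous_gaussianWeight : Continuous (gaussianWeight : Euc d → ℂ) := by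
  unfold gaussianWeight; fun_prop

theorem integrable_exp_neg_mul_norm_sq {b : ℝ} (hb : 0 < b) :
    Integrable (fun x : Euc d => Real.exp (-b * ‖x‖ ^ 2)) := by
  have h := (GaussianFourier.integrable_cexp_neg_mul_sq_norm_add (V := Euc d) (b := (b : ℂ))
    (by simpa using hb) 0 0).norm
  refine h.congr (Filter.Eventually.of_forall fun x => ?_)
  simp only [Complex.norm_exp]
  congr 1
  simp [← Complex.ofReal_pow]

theorem integrable_realEval_mul_gaussianWeight (P : MvPolynomial (Fin d) ℂ) :
    Integrable (fun x => realEval P x * gaussianWeight x) := by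
  obtain ⟨C, k, hC, hk, h⟩ := exists_norm_realEval_le P
  refine ((integrable_exp_neg_mul_norm_sq (d := d) (b := 1 / 4) (by norm_num)).const_mul
    (C * Real.exp (k ^ 2))).mono'
    ((continuous_realEval P).mul continuous_gaussianWeight).aestronglyMeasurable
    (Filter.Eventually.of_forall fun x => ?_)
  rw [norm_mul, gaussianWeight, Complex.norm_real, Real.norm_of_nonneg (Real.exp_pos _).le]
  calc ‖realEval P x‖ * Real.exp (-(‖x‖ ^ 2 / 2))
      ≤ C * Real.exp (k * ‖x‖) * Real.exp (-(‖x‖ ^ 2 / 2)) := by gcongr; exact h x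
    _ = C * Real.exp (k * ‖x‖ + -(‖x‖ ^ 2 / 2)) := by rw [Real.exp_add, mul_assoc]
    -- Completing the square, `k r ≤ k² + r²/4`, leaves half of the Gaussian exponent for
    -- integrability.
    _ ≤ C * Real.exp (k ^ 2 + -(1 / 4) * ‖x‖ ^ 2) := by
      refine mul_le_mul_of_nonneg_left (Real.exp_le_exp.2 ?_) hC
      nlinarith [sq_nonneg (k - ‖x‖ / 2)]
    _ = _ := by rw [Real.exp_add, mul_assoc]

theorem hasLineDerivAt_gaussianWeight (i : Fin d) (x : Euc d) :
    HasLineDerivAt ℝ (gaussianWeight : Euc d → ℂ) (-(x i * gaussianWeight x)) x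
      (EuclideanSpace.single i 1) := by
  unfold HasLineDerivAt gaussianWeight
  have h1 : HasDerivAt (fun t : ℝ => x + t • EuclideanSpace.single i (1 : ℝ))
      (EuclideanSpace.single i 1) 0 := by
    simpa using ((hasDerivAt_id (0 : ℝ)).smul_const (EuclideanSpace.single i (1 : ℝ))).const_add x
  have h2 := ((h1.norm_sq.div_const 2).neg.exp).ofReal_comp
  convert! h2 using 1
  simp [EuclideanSpace.inner_single_right]
  ring

/-- The Gaussian integral of a polynomial. -/
noncomputable def gaussianIntegral (P : MvPolynomial (Fin d) ℂ) : ℂ :=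
  ∫ x, realEval P x * gaussianWeight x

theorem gaussianIntegral_add (P Q : MvPolynomial (Fin d) ℂ) :
    gaussianIntegral (P + Q) = gaussianIntegral P + gaussianIntegral Q := by
  unfold gaussianIntegral
  simp only [realEval_add, add_mul]
  exact integral_add (integrable_realEval_mul_gaussianWeight P)
    (integrable_realEval_mul_gaussianWeight Q)

theorem gaussianIntegral_smul (a : ℂ) (P : MvPolynomial (Fin d) ℂ) :
    gaussianIntegral (a • P) = a * gaussianIntegral P := by
  unfold gaussianIntegral
  simp only [realEval_smul, mul_assoc]
  exact integral_const_mul _ _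

theorem gaussianIntegral_sum {ι : Type*} (s : Finset ι) (P : ι → MvPolynomial (Fin d) ℂ) :
    gaussianIntegral (∑ i ∈ s, P i) = ∑ i ∈ s, gaussianIntegral (P i) := by
  unfold gaussianIntegral
  simp only [realEval_sum, Finset.sum_mul]
  exact integral_finsetSum _ fun i _ => integrable_realEval_mul_gaussianWeight _

/-- Integration by parts: the `i`-th derivative of the weight is `-x_i` times the weight. -/
theorem gaussianIntegral_pderiv (i : Fin d) (P : MvPolynomial (Fin d) ℂ) :
    gaussianIntegral (MvPolynomial.pderiv i P) = gaussianIntegral (MvPolynomial.X i * P) := by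
  have h := integral_bilinear_hasLineDerivAt_right_eq_neg_left_of_integrable
    (μ := (volume : Measure (Euc d))) (B := ContinuousLinearMap.mul ℝ ℂ)
    (f := realEval P) (f' := realEval (MvPolynomial.pderiv i P))
    (g := gaussianWeight) (g' := fun x => -(x i * gaussianWeight x))
    (v := EuclideanSpace.single i 1)
    (integrable_realEval_mul_gaussianWeight _)
    (by
      refine (integrable_realEval_mul_gaussianWeight (MvPolynomial.X i * P)).neg.congr
        (Filter.Eventually.of_forall fun x => ?_)
      simp; ring)
    (integrable_realEval_mul_gaussianWeight _)
    (fun x _ => hasLineDerivAt_realEval P i x) (fun x _ => hasLineDerivAt_gaussianWeight i x)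
  simp only [ContinuousLinearMap.mul_apply', mul_neg, integral_neg, neg_inj] at h
  unfold gaussianIntegral
  rw [← h]
  congr 1
  ext x
  simp; ring

/-- Integrating the outer derivatives by parts leaves `∑ X_i ∂_i P`, which is `k P` by Euler's
identity. Thus the Laplacian acts on Gaussian means as a scalar, and no moments need to be computed.
-/
theorem gaussianIntegral_laplacian {P : MvPolynomial (Fin d) ℂ} {k : ℕ} (hP : P.IsHomogeneous k) :
    gaussianIntegral (laplacian d P) = k * gaussianIntegral P := by
  have h : laplacian d P = ∑ i, MvPolynomial.pderiv i (MvPolynomial.pderiv i P) := by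
    simp [laplacian]
  rw [h, gaussianIntegral_sum]
  simp only [gaussianIntegral_pderiv]
  rw [← gaussianIntegral_sum, hP.sum_X_mul_pderiv, ← gaussianIntegral_smul, Nat.cast_smul_eq_nsmul]

end gaussian

/-! ### Polar coordinates -/

section polar

variable {m : ℕ}

/-- Integration in polar coordinates. -/
theorem integral_eq_integral_prod_sphere [Nontrivial (Euc m)] (g : Euc m → ℂ) :
    ∫ x, g x = ∫ z : UnitSphere m × Set.Ioi (0 : ℝ), g ((z.2 : ℝ) • (z.1 : Euc m))
      ∂(sphereMeasure m).prod (Measure.volumeIoiPow (m - 1)) := by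
  have h := ((volume : Measure (Euc m)).measurePreserving_homeomorphUnitSphereProd).integral_comp
    (Homeomorph.measurableEmbedding _)
    (fun z : UnitSphere m × Set.Ioi (0 : ℝ) => g ((z.2 : ℝ) • (z.1 : Euc m)))
  rw [finrank_euclideanSpace_fin] at h
  have hx : ∀ x : ({0}ᶜ : Set (Euc m)), g (((homeomorphUnitSphereProd (Euc m) x).2 : ℝ) •
      ((homeomorphUnitSphereProd (Euc m) x).1 : Euc m)) = g x := fun x => by
    rw [homeomorphUnitSphereProd_apply_fst_coe, homeomorphUnitSphereProd_apply_snd_coe,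
      smul_inv_smul₀ (norm_ne_zero_iff.2 x.2)]
  simp only [hx] at h
  rw [← h, integral_subtype_comap (measurableSet_singleton _).compl g, restrict_compl_singleton]

/-- Integration of nonnegative functions in polar coordinates. -/
theorem lintegral_eq_lintegral_sphere [Nontrivial (Euc m)] {g : Euc m → ENNReal}
    (hg : Measurable g) :
    ∫⁻ x, g x = ∫⁻ ω : UnitSphere m, (∫⁻ r in Set.Ioi (0 : ℝ), ENNReal.ofReal (r ^ (m - 1)) *
      g (r • (ω : Euc m))) ∂sphereMeasure m := by
  have h := ((volume : Measure (Euc m)).measurePreserving_homeomorphUnitSphereProd).lintegral_comp_emb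
    (Homeomorph.measurableEmbedding _)
    (fun z : UnitSphere m × Set.Ioi (0 : ℝ) => g ((z.2 : ℝ) • (z.1 : Euc m)))
  rw [finrank_euclideanSpace_fin] at h
  have hm : Measurable (fun z : UnitSphere m × Set.Ioi (0 : ℝ) =>
      g ((z.2 : ℝ) • (z.1 : Euc m))) := by
    apply hg.comp
    fun_prop
  rw [← restrict_compl_singleton (μ := (volume : Measure (Euc m))) 0,
    ← lintegral_subtype_comap (measurableSet_singleton _).compl g]
  calc _ = _ := ?_
    _ = _ := h
    _ = _ := ?_
  · refine lintegral_congr fun x => ?_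
    simp only [homeomorphUnitSphereProd_apply_fst_coe (Euc m),
      homeomorphUnitSphereProd_apply_snd_coe (Euc m)]
    rw [smul_inv_smul₀ (norm_ne_zero_iff.2 x.2)]
  · rw [lintegral_prod _ hm.aemeasurable]
    refine lintegral_congr fun ω => ?_
    rw [Measure.volumeIoiPow, lintegral_withDensity_eq_lintegral_mul _ (by fun_prop)
      (by apply hg.comp; fun_prop)]
    exact lintegral_subtype_comap measurableSet_Ioi
      (fun r : ℝ => ENNReal.ofReal (r ^ (m - 1)) * g (r • (ω : Euc m)))

/-- In polar coordinates a homogeneous integrand separates. The radial factor depends only on the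
degree and is a positive Gamma integral, so Gaussian and spherical means vanish together. -/
theorem exists_gaussianIntegral_eq_mul_sphere (hm : 0 < m) (k : ℕ) :
    ∃ c : ℂ, c ≠ 0 ∧ ∀ P : MvPolynomial (Fin m) ℂ, P.IsHomogeneous k →
      gaussianIntegral P = c * ∫ ω, realEval P (ω : Euc m) ∂sphereMeasure m := by
  have : Nonempty (Fin m) := ⟨⟨0, hm⟩⟩
  set w : ℝ → ℝ := fun r => r ^ k * Real.exp (-(r ^ 2 / 2)) with hw
  refine ⟨((∫ r : Set.Ioi (0 : ℝ), w r ∂Measure.volumeIoiPow (m - 1) : ℝ) : ℂ), ?_, ?_⟩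
  · rw [Complex.ofReal_ne_zero]
    have h1 : ∫ r : Set.Ioi (0 : ℝ), w r ∂Measure.volumeIoiPow (m - 1) =
        ∫ r in Set.Ioi (0 : ℝ), r ^ ((m - 1 + k : ℕ) : ℝ) * Real.exp (-(1 / 2) * r ^ (2 : ℝ)) := by
      simp only [Measure.volumeIoiPow, ENNReal.ofReal]
      rw [integral_withDensity_eq_integral_smul,
        integral_subtype_comap measurableSet_Ioi fun a ↦ Real.toNNReal (a ^ (m - 1)) • w a,
        setIntegral_congr_fun measurableSet_Ioi fun x hx ↦ ?_]
      · rw [NNReal.smul_def, Real.coe_toNNReal _ (pow_nonneg (le_of_lt hx) _), hw, smul_eq_mul,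
          Real.rpow_natCast, pow_add, mul_assoc]
        congr 3
        rw [show (2 : ℝ) = ((2 : ℕ) : ℝ) by norm_num, Real.rpow_natCast]
        push_cast; ring_nf
      · exact (measurable_subtype_coe.pow_const _).real_toNNReal
    rw [h1, integral_rpow_mul_exp_neg_mul_rpow (by norm_num)
      (by have : (0 : ℝ) ≤ ((m - 1 + k : ℕ) : ℝ) := Nat.cast_nonneg _
          linarith) (by norm_num)]
    have : 0 < Real.Gamma ((((m - 1 + k : ℕ) : ℝ) + 1) / 2) := Real.Gamma_pos_of_pos (by positivity)
    positivity
  · intro P hP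
    unfold gaussianIntegral
    rw [integral_eq_integral_prod_sphere, ← integral_complex_ofReal, mul_comm, ← integral_prod_mul
      (fun ω : UnitSphere m => realEval P (ω : Euc m))
      (fun r : Set.Ioi (0 : ℝ) => ((w r : ℝ) : ℂ))]
    refine integral_congr_ae (Filter.Eventually.of_forall fun z => ?_)
    simp only [realEval_homogeneous_smul hP, gaussianWeight, norm_smul, norm_eq_of_mem_sphere,
      mul_one, hw, Real.norm_eq_abs, sq_abs]
    push_cast
    ring

end polar

/-! ### Slices of harmonic polynomials and their means over parallels -/

/-- The point of `ℝ^(d+1)` with first coordinate `t` and remaining coordinates `x`. -/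
noncomputable def consVec {d : ℕ} (t : ℝ) (x : Euc d) : Euc (d + 1) :=
  WithLp.toLp 2 (Fin.cons t x)

section slices

variable {d : ℕ}

@[simp] theorem consVec_zero (t : ℝ) (x : Euc d) : consVec t x 0 = t := rfl

@[simp] theorem consVec_succ (t : ℝ) (x : Euc d) (i : Fin d) : consVec t x i.succ = x i := rfl

/-- The coefficient of `X_0 ^ j`, as a polynomial in the remaining variables. -/
noncomputable def sliceCoeff (W : MvPolynomial (Fin (d + 1)) ℂ) (j : ℕ) :
    MvPolynomial (Fin d) ℂ :=
  (MvPolynomial.finSuccEquiv ℂ d W).coeff j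

theorem coeff_sliceCoeff (W : MvPolynomial (Fin (d + 1)) ℂ) (j : ℕ) (s : Fin d →₀ ℕ) :
    (sliceCoeff W j).coeff s = W.coeff (s.cons j) :=
  MvPolynomial.finSuccEquiv_coeff_coeff s W j

theorem sliceCoeff_pderiv_zero (W : MvPolynomial (Fin (d + 1)) ℂ) (j : ℕ) :
    sliceCoeff (MvPolynomial.pderiv 0 W) j = ((j : ℂ) + 1) • sliceCoeff W (j + 1) := by
  ext s
  rw [MvPolynomial.coeff_smul, coeff_sliceCoeff, coeff_sliceCoeff, MvPolynomial.coeff_pderiv]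
  have h : s.cons j + Finsupp.single 0 1 = s.cons (j + 1) := by
    ext i
    refine Fin.cases ?_ (fun i => ?_) i <;> simp
  rw [h]
  simp [mul_comm]

theorem sliceCoeff_pderiv_succ (W : MvPolynomial (Fin (d + 1)) ℂ) (i : Fin d) (j : ℕ) :
    sliceCoeff (MvPolynomial.pderiv i.succ W) j = MvPolynomial.pderiv i (sliceCoeff W j) := by
  ext s
  rw [coeff_sliceCoeff, MvPolynomial.coeff_pderiv, MvPolynomial.coeff_pderiv, coeff_sliceCoeff]
  have h : s.cons j + Finsupp.single i.succ 1 = (s + Finsupp.single i 1).cons j := by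
    ext l
    refine Fin.cases ?_ (fun l => ?_) l
    · simp
    · simp [Finsupp.single_apply]
  rw [h]
  simp

/-- Split the Laplacian into `∂₀²` and the Laplacian in the other variables, and compare
coefficients of `X₀^j`. For harmonic `W` this expresses the Laplacian of one slice through the slice
two steps higher. -/
theorem sliceCoeff_laplacian (W : MvPolynomial (Fin (d + 1)) ℂ) (j : ℕ) :
    sliceCoeff (laplacian (d + 1) W) j =
      (((j : ℂ) + 1) * ((j : ℂ) + 2)) • sliceCoeff W (j + 2) + laplacian d (sliceCoeff W j) := by
  have hadd : sliceCoeff (laplacian (d + 1) W) j =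
      sliceCoeff (MvPolynomial.pderiv 0 (MvPolynomial.pderiv 0 W)) j +
        ∑ i : Fin d, sliceCoeff (MvPolynomial.pderiv i.succ (MvPolynomial.pderiv i.succ W)) j := by
    simp [laplacian, sliceCoeff, Fin.sum_univ_succ, Polynomial.finsetSum_coeff]
  rw [hadd, sliceCoeff_pderiv_zero, sliceCoeff_pderiv_zero, smul_smul]
  simp only [sliceCoeff_pderiv_succ]
  congr 1
  · push_cast; ring_nf
  · simp [laplacian]

theorem sliceCoeff_isHomogeneous {W : MvPolynomial (Fin (d + 1)) ℂ} {n : ℕ}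
    (hW : W.IsHomogeneous n) {i j : ℕ} (h : i + j = n) : (sliceCoeff W i).IsHomogeneous j :=
  hW.finSuccEquiv_coeff_isHomogeneous i j h

theorem sliceCoeff_eq_zero {W : MvPolynomial (Fin (d + 1)) ℂ} {n : ℕ}
    (hW : W.IsHomogeneous n) {j : ℕ} (h : n < j) : sliceCoeff W j = 0 := by
  ext s
  rw [coeff_sliceCoeff, MvPolynomial.coeff_zero]
  refine hW.coeff_eq_zero ?_
  rw [Finsupp.degree_eq_sum, Fin.sum_univ_succ, Finsupp.cons_zero]
  omega

theorem realEval_consVec {W : MvPolynomial (Fin (d + 1)) ℂ} {n : ℕ} (hW : W.IsHomogeneous n)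
    (t : ℝ) (x : Euc d) :
    realEval W (consVec t x) =
      ∑ j ∈ Finset.range (n + 1), realEval (sliceCoeff W j) x * (t : ℂ) ^ j := by
  have h1 : (fun i => ((consVec t x i : ℝ) : ℂ)) =
      (Fin.cons (t : ℂ) (fun i => (x i : ℂ)) : Fin (d + 1) → ℂ) := by
    ext i
    refine Fin.cases ?_ (fun i => ?_) i <;> simp
  unfold realEval
  rw [h1, MvPolynomial.eval_eq_eval_mv_eval', Polynomial.eval_eq_sum_range' (n := n + 1)]
  · simp [sliceCoeff]
  · refine lt_of_le_of_lt Polynomial.natDegree_map_le (Nat.lt_succ_of_le ?_)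
    rw [Polynomial.natDegree_le_iff_coeff_eq_zero]
    exact fun j hj => sliceCoeff_eq_zero hW hj

theorem gaussianIntegral_zero : gaussianIntegral (0 : MvPolynomial (Fin d) ℂ) = 0 := by
  simp [gaussianIntegral]

/-- If a homogeneous harmonic polynomial vanishes at the pole, then the Gaussian integrals of its
slice coefficients vanish. -/
theorem gaussianIntegral_sliceCoeff_eq_zero {W : MvPolynomial (Fin (d + 1)) ℂ} {n : ℕ}
    (hW : W ∈ harmonicPolynomials (d + 1) n) (h0 : realEval W (consVec 1 0) = 0) (k : ℕ) :
    ∀ j, j + k = n → gaussianIntegral (sliceCoeff W j) = 0 := by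
  have hhom : W.IsHomogeneous n := hW.1
  -- Taking Gaussian means of the slice identity gives a scalar recursion. For `k ≠ 0` it determines
  -- the mean at `j` from the mean at `j + 2`.
  have hrec : ∀ j k, j + k = n → (k : ℂ) * gaussianIntegral (sliceCoeff W j) =
      -((((j : ℂ) + 1) * ((j : ℂ) + 2)) * gaussianIntegral (sliceCoeff W (j + 2))) := by
    intro j k hjk
    have h1 := sliceCoeff_laplacian W j
    have h2 : laplacian (d + 1) W = 0 := hW.2
    rw [h2] at h1
    have h3 : sliceCoeff (0 : MvPolynomial (Fin (d + 1)) ℂ) j = 0 := by simp [sliceCoeff]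
    rw [h3] at h1
    rw [← gaussianIntegral_laplacian (sliceCoeff_isHomogeneous hhom hjk), ← gaussianIntegral_smul,
      eq_neg_iff_add_eq_zero, add_comm, ← gaussianIntegral_add, ← h1, gaussianIntegral_zero]
  induction k using Nat.strong_induction_on with
  | _ k ih =>
    intro j hjk
    match k, ih with
    -- The top slice is constant. It equals the value at the pole, since all other slices have
    -- positive degree and vanish at the origin.
    | 0, _ =>
      have hj : j = n := by omega
      subst hj
      have h1 := sliceCoeff_isHomogeneous hhom hjk
      have h2 := realEval_consVec hhom 1 0
      rw [h0, Finset.sum_range_succ, Finset.sum_eq_zero, zero_add] at h2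
      · have h3 : (sliceCoeff W j) = MvPolynomial.C ((sliceCoeff W j).coeff 0) := by
          rw [← MvPolynomial.totalDegree_eq_zero_iff_eq_C]
          exact Nat.le_zero.1 h1.totalDegree_le
        rw [h3] at h2 ⊢
        simp only [realEval_C, Complex.ofReal_one, one_pow, mul_one] at h2
        rw [← h2]
        simp [gaussianIntegral]
      · intro i hi
        have hi' : i + (j - i) = j := by have := Finset.mem_range.1 hi; omega
        have h4 := realEval_homogeneous_smul (sliceCoeff_isHomogeneous hhom hi') 0 (0 : Euc d)
        have h5 : j - i ≠ 0 := by have := Finset.mem_range.1 hi; omega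
        rw [smul_zero, Complex.ofReal_zero, zero_pow h5, zero_mul] at h4
        rw [h4, zero_mul]
    -- Here the recursion refers to the slice `n + 1`, beyond the degree, so this parity class
    -- vanishes without using the value at the pole.
    | 1, _ =>
      have h1 := hrec j 1 hjk
      rw [sliceCoeff_eq_zero hhom (show n < j + 2 by omega), gaussianIntegral_zero] at h1
      simpa using h1
    | k + 2, ih =>
      have h1 := hrec j (k + 2) hjk
      rw [ih k (by omega) (j + 2) (by omega), mul_zero, neg_zero, mul_eq_zero] at h1
      exact h1.resolve_left (Nat.cast_ne_zero.2 (Nat.succ_ne_zero (k + 1)))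

theorem integrable_realEval_sphere {m : ℕ} (P : MvPolynomial (Fin m) ℂ) :
    Integrable (fun ω : UnitSphere m => realEval P (ω : Euc m)) (sphereMeasure m) :=
  ((continuous_realEval P).comp continuous_subtype_val).integrable_of_hasCompactSupport
    (HasCompactSupport.of_compactSpace _)

/-- If a homogeneous harmonic polynomial vanishes at the pole, then its means over the spheres
with axis through the pole vanish. -/
theorem integral_slice_eq_zero (hd : 0 < d) {W : MvPolynomial (Fin (d + 1)) ℂ} {n : ℕ}
    (hW : W ∈ harmonicPolynomials (d + 1) n) (h0 : realEval W (consVec 1 0) = 0) (t r : ℝ) :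
    ∫ η : UnitSphere d, realEval W (consVec t (r • (η : Euc d))) ∂sphereMeasure d = 0 := by
  have hhom : W.IsHomogeneous n := hW.1
  simp only [realEval_consVec hhom]
  have hs : ∀ j ∈ Finset.range (n + 1), ∀ η : UnitSphere d,
      realEval (sliceCoeff W j) (r • (η : Euc d)) =
        (r : ℂ) ^ (n - j) * realEval (sliceCoeff W j) (η : Euc d) := by
    intro j hj η
    have hj' : j + (n - j) = n := by have := Finset.mem_range.1 hj; omega
    exact realEval_homogeneous_smul (sliceCoeff_isHomogeneous hhom hj') r _
  have h1 : ∀ η : UnitSphere d, ∑ j ∈ Finset.range (n + 1),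
      realEval (sliceCoeff W j) (r • (η : Euc d)) * (t : ℂ) ^ j =
      ∑ j ∈ Finset.range (n + 1),
        ((r : ℂ) ^ (n - j) * (t : ℂ) ^ j) * realEval (sliceCoeff W j) (η : Euc d) := by
    intro η
    refine Finset.sum_congr rfl fun j hj => ?_
    rw [hs j hj η]; ring
  simp only [h1]
  rw [integral_finsetSum _ fun j _ => (integrable_realEval_sphere _).const_mul _]
  refine Finset.sum_eq_zero fun j hj => ?_
  have hj' : j + (n - j) = n := by have := Finset.mem_range.1 hj; omega
  -- Each slice is homogeneous, so its vanishing Gaussian mean forces its spherical mean to vanish.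
  obtain ⟨c, hc, h⟩ := exists_gaussianIntegral_eq_mul_sphere hd (n - j)
  have h2 := h _ (sliceCoeff_isHomogeneous hhom hj')
  rw [gaussianIntegral_sliceCoeff_eq_zero hW h0 _ j hj', eq_comm, mul_eq_zero] at h2
  rw [integral_const_mul, h2.resolve_left hc, mul_zero]

end slices

/-! ### Isotropic linear forms and rotations -/

theorem mem_harmonicPolynomials {m n : ℕ} {P : MvPolynomial (Fin m) ℂ} :
    P ∈ harmonicPolynomials m n ↔ P.IsHomogeneous n ∧
      ∑ i, MvPolynomial.pderiv i (MvPolynomial.pderiv i P) = 0 := by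
  have h : laplacian m P = ∑ i, MvPolynomial.pderiv i (MvPolynomial.pderiv i P) := by
    simp [laplacian]
  rw [← h]
  rfl

section linear

variable {m : ℕ}

/-- The linear form with coefficients `a`. -/
noncomputable def linearForm (a : Fin m → ℂ) : MvPolynomial (Fin m) ℂ :=
  ∑ i, MvPolynomial.C (a i) * MvPolynomial.X i

theorem linearForm_isHomogeneous (a : Fin m → ℂ) : (linearForm a).IsHomogeneous 1 :=
  MvPolynomial.IsHomogeneous.sum _ _ _ fun i _ => MvPolynomial.isHomogeneous_C_mul_X (a i) i

theorem pderiv_linearForm (a : Fin m → ℂ) (i : Fin m) :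
    MvPolynomial.pderiv i (linearForm a) = MvPolynomial.C (a i) := by
  simp [linearForm, MvPolynomial.pderiv_X, Pi.single_apply]

theorem realEval_linearForm (a : Fin m → ℂ) (x : Euc m) :
    realEval (linearForm a) x = ∑ i, a i * x i := by
  simp [linearForm]

/-- Powers of isotropic linear forms are harmonic. -/
theorem linearForm_pow_mem (a : Fin m → ℂ) (ha : ∑ i, a i ^ 2 = 0) (n : ℕ) :
    linearForm a ^ n ∈ harmonicPolynomials m n := by
  rw [mem_harmonicPolynomials]
  refine ⟨by simpa using (linearForm_isHomogeneous a).pow n, ?_⟩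
  -- The truncated exponent `n - 1 - 1` is harmless for `n < 2`, because the factor `n (n - 1)` is
  -- then zero.
  have h : ∀ i, MvPolynomial.pderiv i (MvPolynomial.pderiv i (linearForm a ^ n)) =
      ((n : MvPolynomial (Fin m) ℂ) * ((n - 1 : ℕ) : MvPolynomial (Fin m) ℂ) *
        linearForm a ^ (n - 1 - 1)) * MvPolynomial.C (a i ^ 2) := by
    intro i
    have h1 : MvPolynomial.pderiv i (n : MvPolynomial (Fin m) ℂ) = 0 :=
      Derivation.map_natCast _ n
    simp only [MvPolynomial.pderiv_pow, MvPolynomial.pderiv_mul, pderiv_linearForm,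
      MvPolynomial.pderiv_C, h1, map_pow]
    ring
  simp only [h]
  rw [← Finset.mul_sum, ← map_sum, ha, map_zero, mul_zero]

/-- Substitution of an isometry into a polynomial. -/
noncomputable def rotate (L : Euc m ≃ₗᵢ[ℝ] Euc m) (P : MvPolynomial (Fin m) ℂ) :
    MvPolynomial (Fin m) ℂ :=
  MvPolynomial.bind₁
    (fun j => linearForm fun i => ((L (EuclideanSpace.single i 1) j : ℝ) : ℂ)) P

theorem realEval_rotate (L : Euc m ≃ₗᵢ[ℝ] Euc m) (P : MvPolynomial (Fin m) ℂ) (x : Euc m) :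
    realEval (rotate L P) x = realEval P (L x) := by
  have h : ∀ j, ((L x j : ℝ) : ℂ) =
      ∑ i, ((L (EuclideanSpace.single i 1) j : ℝ) : ℂ) * (x i : ℂ) := by
    intro j
    have h1 : x = ∑ i, x i • EuclideanSpace.single i (1 : ℝ) := by
      ext k; simp [Pi.single_apply]
    conv_lhs => rw [h1]
    simp [mul_comm]
  unfold rotate
  induction P using MvPolynomial.induction_on with
  | C a => simp
  | add P Q hP hQ => simp only [map_add, realEval_add, hP, hQ]
  | mul_X P j hP =>
    simp only [map_mul, realEval_mul, hP, MvPolynomial.bind₁_X_right, realEval_linearForm,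
      realEval_X, h j]

theorem pderiv_rotate (L : Euc m ≃ₗᵢ[ℝ] Euc m) (P : MvPolynomial (Fin m) ℂ) (i : Fin m) :
    MvPolynomial.pderiv i (rotate L P) =
      ∑ j, MvPolynomial.C ((L (EuclideanSpace.single i 1) j : ℝ) : ℂ) *
        rotate L (MvPolynomial.pderiv j P) := by
  unfold rotate
  induction P using MvPolynomial.induction_on with
  | C a => simp
  | add P Q hP hQ => simp only [map_add, hP, hQ, mul_add, Finset.sum_add_distrib]
  | mul_X P j hP =>
    simp only [map_mul, MvPolynomial.pderiv_mul, hP, MvPolynomial.bind₁_X_right, map_add,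
      pderiv_linearForm, mul_add, Finset.sum_add_distrib]
    congr 1
    · rw [Finset.sum_mul]
      exact Finset.sum_congr rfl fun k _ => by ring
    · rw [Finset.sum_eq_single j]
      · simp [mul_comm]
      · intro k _ hk
        rw [MvPolynomial.pderiv_X_of_ne hk.symm]; simp
      · simp

/-- The entries of the matrix of `L` are those of `L⁻¹` transposed, and `L⁻¹` preserves inner
products; hence the rows are orthonormal. -/
theorem sum_isometry_mul (L : Euc m ≃ₗᵢ[ℝ] Euc m) (j k : Fin m) :
    ∑ i, L (EuclideanSpace.single i 1) j * L (EuclideanSpace.single i 1) k =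
      if j = k then 1 else 0 := by
  have h : ∀ i l, L (EuclideanSpace.single i 1) l =
      L.symm (EuclideanSpace.single l (1 : ℝ)) i := by
    intro i l
    have h1 := L.inner_map_eq_flip (EuclideanSpace.single i 1) (EuclideanSpace.single l (1 : ℝ))
    simpa [EuclideanSpace.inner_single_left, EuclideanSpace.inner_single_right] using h1
  simp only [h]
  have h2 := L.symm.inner_map_map (EuclideanSpace.single j (1 : ℝ)) (EuclideanSpace.single k 1)
  rw [PiLp.inner_apply] at h2
  simp only [RCLike.inner_apply, conj_trivial, EuclideanSpace.inner_single_left] at h2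
  simp only [mul_comm] at h2 ⊢
  rw [h2]
  simp

/-- By the chain rule the second derivatives of the rotated polynomial are contracted with `L Lᵀ`,
which is the identity, so the Laplacian commutes with rotation. -/
theorem rotate_mem (L : Euc m ≃ₗᵢ[ℝ] Euc m) {n : ℕ} {P : MvPolynomial (Fin m) ℂ}
    (hP : P ∈ harmonicPolynomials m n) : rotate L P ∈ harmonicPolynomials m n := by
  rw [mem_harmonicPolynomials] at hP ⊢
  refine ⟨?_, ?_⟩
  · have h := hP.1.aeval (R := ℂ) (n := 1)
      (fun j => linearForm fun i => ((L (EuclideanSpace.single i 1) j : ℝ) : ℂ))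
      fun j => linearForm_isHomogeneous _
    rwa [one_mul] at h
  · have h : ∀ i, MvPolynomial.pderiv i (MvPolynomial.pderiv i (rotate L P)) =
        ∑ j, ∑ k, MvPolynomial.C ((L (EuclideanSpace.single i 1) j *
          L (EuclideanSpace.single i 1) k : ℝ) : ℂ) *
            rotate L (MvPolynomial.pderiv k (MvPolynomial.pderiv j P)) := by
      intro i
      simp only [pderiv_rotate, map_sum, MvPolynomial.pderiv_C_mul, Finset.mul_sum]
      refine Finset.sum_congr rfl fun j _ => Finset.sum_congr rfl fun k _ => ?_
      rw [Complex.ofReal_mul, map_mul, mul_assoc]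
    simp only [h]
    rw [Finset.sum_comm]
    have h2 : ∀ j, ∑ i, ∑ k, MvPolynomial.C ((L (EuclideanSpace.single i 1) j *
          L (EuclideanSpace.single i 1) k : ℝ) : ℂ) *
            rotate L (MvPolynomial.pderiv k (MvPolynomial.pderiv j P)) =
        rotate L (MvPolynomial.pderiv j (MvPolynomial.pderiv j P)) := by
      intro j
      rw [Finset.sum_comm]
      rw [Finset.sum_eq_single j]
      · rw [← Finset.sum_mul, ← map_sum, ← Complex.ofReal_sum, sum_isometry_mul]
        simp
      · intro k _ hk
        rw [← Finset.sum_mul, ← map_sum, ← Complex.ofReal_sum, sum_isometry_mul]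
        simp [hk.symm]
      · simp
    simp only [h2]
    unfold rotate
    rw [← map_sum, hP.2, map_zero]

/-- The action of an isometry on the sphere. -/
noncomputable def sphereIsometry (L : Euc m ≃ₗᵢ[ℝ] Euc m) : UnitSphere m ≃ₜ UnitSphere m where
  toFun x := ⟨L x, by simp⟩
  invFun x := ⟨L.symm x, by simp⟩
  left_inv x := by ext1; simp
  right_inv x := by ext1; simp
  continuous_toFun := by fun_prop
  continuous_invFun := by fun_prop

@[simp] theorem coe_sphereIsometry (L : Euc m ≃ₗᵢ[ℝ] Euc m) (x : UnitSphere m) :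
    (sphereIsometry L x : Euc m) = L x := rfl

-- Surface measure is the dimension times the volume of the cone over a set; an isometry preserves
-- volume and maps cones to cones.
open scoped Pointwise in
theorem measurePreserving_sphereIsometry (L : Euc m ≃ₗᵢ[ℝ] Euc m) :
    MeasurePreserving (sphereIsometry L) (sphereMeasure m) (sphereMeasure m) := by
  refine ⟨(sphereIsometry L).measurable, ?_⟩
  ext s hs
  have hs' : MeasurableSet (sphereIsometry L ⁻¹' s) := (sphereIsometry L).measurable hs
  rw [Measure.map_apply (sphereIsometry L).measurable hs, Measure.toSphere_apply' _ hs,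
    Measure.toSphere_apply' _ hs']
  congr 1
  conv_rhs => rw [← L.measurePreserving.measure_preimage_emb L.toHomeomorph.measurableEmbedding]
  congr 1
  ext x
  simp only [Set.mem_smul, Set.mem_image, Set.mem_preimage]
  constructor
  · rintro ⟨r, hr, _, ⟨y, hy, rfl⟩, rfl⟩
    exact ⟨r, hr, _, ⟨_, hy, rfl⟩, by simp⟩
  · rintro ⟨r, hr, _, ⟨y, hy, rfl⟩, h⟩
    refine ⟨r, hr, _, ⟨(sphereIsometry L).symm y, by simpa using hy, rfl⟩, ?_⟩
    apply L.injective
    rw [← h, map_smul]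
    exact congrArg (r • ·) (L.apply_symm_apply y)

theorem integral_sphereIsometry (L : Euc m ≃ₗᵢ[ℝ] Euc m) (g : UnitSphere m → ℂ) :
    ∫ x, g (sphereIsometry L x) ∂sphereMeasure m = ∫ x, g x ∂sphereMeasure m :=
  (measurePreserving_sphereIsometry L).integral_comp (sphereIsometry L).measurableEmbedding g

/-- The reflection in the hyperplane orthogonal to `v - w` suffices, as orientation plays no role.
-/
theorem exists_isometry_map_eq {v w : Euc m} (h : ‖v‖ = ‖w‖) :
    ∃ L : Euc m ≃ₗᵢ[ℝ] Euc m, L v = w :=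
  ⟨_, Submodule.reflection_sub h⟩

end linear

/-! ### Laplace's formula -/

section zonal

variable {d : ℕ} [NeZero d]

/-- The spherical mean `∫ (t + i r η₀)^n dσ(η)`. -/
noncomputable def laplaceMean (d : ℕ) [NeZero d] (n : ℕ) (t r : ℝ) : ℂ :=
  ∫ η : UnitSphere d, ((t : ℂ) + Complex.I * r * ((η : Euc d) 0 : ℝ)) ^ n ∂sphereMeasure d

/-- Laplace's formula: spherical means of homogeneous harmonic polynomials. -/
theorem integral_slice_eq {W : MvPolynomial (Fin (d + 1)) ℂ} {n : ℕ}
    (hW : W ∈ harmonicPolynomials (d + 1) n) (t r : ℝ) :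
    ∫ η : UnitSphere d, realEval W (consVec t (r • (η : Euc d))) ∂sphereMeasure d =
      realEval W (consVec 1 0) * laplaceMean d n t r := by
  -- The vector `(1, i, 0, …, 0)` is isotropic, so `(X₀ + i X₁)^n` is harmonic; its value at the
  -- pole is `1`.
  set a : Fin (d + 1) → ℂ := Fin.cons 1 (Pi.single 0 Complex.I) with ha
  have ha1 : a (Fin.succ 0) = Complex.I := by rw [ha, Fin.cons_succ, Pi.single_eq_same]
  have ha0 : ∑ i, a i ^ 2 = 0 := by
    rw [Fin.sum_univ_succ, Finset.sum_eq_single 0]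
    · rw [ha1]; simp [ha]
    · intro i _ hi; simp [ha, hi]
    · simp
  have hu : ∀ (t : ℝ) (x : Euc d), realEval (linearForm a ^ n) (consVec t x) =
      ((t : ℂ) + Complex.I * (x 0 : ℝ)) ^ n := by
    intro t x
    rw [realEval_pow, realEval_linearForm, Fin.sum_univ_succ, Finset.sum_eq_single 0]
    · rw [ha1, consVec_succ]; simp [ha]
    · intro i _ hi; simp [ha, hi]
    · simp
  -- Subtracting the right multiple of this model polynomial makes the difference vanish at the
  -- pole, hence in mean over every parallel.
  have hV := (harmonicPolynomials (d + 1) n).sub_mem hW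
    ((harmonicPolynomials (d + 1) n).smul_mem (realEval W (consVec 1 0))
      (linearForm_pow_mem a ha0 n))
  have h := integral_slice_eq_zero (NeZero.pos d) hV (by simp [hu]) t r
  have hint : ∀ P : MvPolynomial (Fin (d + 1)) ℂ, Integrable
      (fun η : UnitSphere d => realEval P (consVec t (r • (η : Euc d)))) (sphereMeasure d) := by
    intro P
    refine Continuous.integrable_of_hasCompactSupport ?_ (HasCompactSupport.of_compactSpace _)
    refine (continuous_realEval P).comp ?_
    unfold consVec
    refine (PiLp.continuous_toLp 2 _).comp (continuous_pi fun i => ?_)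
    refine Fin.cases ?_ (fun i => ?_) i
    · simpa using continuous_const
    · simp only [Fin.cons_succ]; fun_prop
  simp only [realEval_sub, realEval_smul] at h
  rw [integral_sub (hint _) ((hint _).const_mul _), integral_const_mul, sub_eq_zero] at h
  rw [h, laplaceMean]
  congr 2
  ext η
  rw [hu]
  simp [mul_assoc]

end zonal

/-! ### Dimension of the spaces of harmonics -/

section dimension

open Finset in
/-- Homogeneous polynomials are given by their coefficients. -/
noncomputable def homogeneousEquiv (m n : ℕ) :
    MvPolynomial.homogeneousSubmodule (Fin m) ℂ n ≃ₗ[ℂ]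
      ((univ : Finset (Fin m)).finsuppAntidiag n → ℂ) where
  toFun P s := MvPolynomial.coeff s.1 P.1
  map_add' P Q := by ext s; simp
  map_smul' a P := by ext s; simp
  invFun f := ⟨∑ s, MvPolynomial.monomial s.1 (f s), Submodule.sum_mem _ fun s _ => by
    refine MvPolynomial.isHomogeneous_monomial _ ?_
    rw [Finsupp.degree_eq_sum]
    exact (mem_finsuppAntidiag.1 s.2).1⟩
  left_inv P := by
    ext s
    rw [MvPolynomial.coeff_sum]
    simp only [MvPolynomial.coeff_monomial]
    by_cases hs : s ∈ (univ : Finset (Fin m)).finsuppAntidiag n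
    · rw [Finset.sum_eq_single ⟨s, hs⟩]
      · simp
      · intro t _ ht
        rw [if_neg fun h => ht (Subtype.ext h)]
      · simp
    · rw [Finset.sum_eq_zero, eq_comm]
      · refine MvPolynomial.IsHomogeneous.coeff_eq_zero P.2 fun h => hs ?_
        rw [Finsupp.degree_eq_sum] at h
        simpa using h
      · intro t _
        rw [if_neg]
        rintro rfl
        exact hs t.2
  right_inv f := by
    ext s
    simp only [MvPolynomial.coeff_sum, MvPolynomial.coeff_monomial]
    rw [Finset.sum_eq_single s]
    · simp
    · intro t _ ht
      rw [if_neg fun h => ht (Subtype.ext h)]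
    · simp

instance (m n : ℕ) : FiniteDimensional ℂ (MvPolynomial.homogeneousSubmodule (Fin m) ℂ n) :=
  (homogeneousEquiv m n).symm.finiteDimensional

theorem finrank_homogeneousSubmodule (m n : ℕ) :
    Module.finrank ℂ (MvPolynomial.homogeneousSubmodule (Fin m) ℂ n) = (m + n - 1).choose n := by
  rw [(homogeneousEquiv m n).finrank_eq, Module.finrank_fintype_fun_eq_card, Fintype.card_coe,
    Finset.card_finsuppAntidiag_nat_eq_choose, Finset.card_univ, Fintype.card_fin]

/-- Rank-nullity for the Laplacian. Only a lower bound is wanted, so its surjectivity is not needed.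
-/
theorem le_finrank_harmonicPolynomials (m n : ℕ) :
    Module.finrank ℂ (MvPolynomial.homogeneousSubmodule (Fin m) ℂ (n + 2)) ≤
      Module.finrank ℂ (harmonicPolynomials m (n + 2)) +
        Module.finrank ℂ (MvPolynomial.homogeneousSubmodule (Fin m) ℂ n) := by
  set V := MvPolynomial.homogeneousSubmodule (Fin m) ℂ (n + 2)
  set f := (laplacian m).domRestrict V
  have h1 := f.finrank_range_add_finrank_ker
  have h2 : LinearMap.range f ≤ MvPolynomial.homogeneousSubmodule (Fin m) ℂ n := by
    rintro _ ⟨P, rfl⟩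
    have h : f P = ∑ i, MvPolynomial.pderiv i (MvPolynomial.pderiv i P.1) := by
      simp [f, laplacian]
    rw [h]
    refine Submodule.sum_mem _ fun i _ => ?_
    have hP : P.1.IsHomogeneous (n + 2) := P.2
    exact hP.pderiv.pderiv
  have h3 := Submodule.finrank_mono h2
  have h4 : Module.finrank ℂ (LinearMap.ker f) = Module.finrank ℂ (harmonicPolynomials m (n + 2)) := by
    have h5 : Submodule.map V.subtype (LinearMap.ker f) = harmonicPolynomials m (n + 2) := by
      ext P
      simp [harmonicPolynomials, f, V, and_comm]
    rw [← Submodule.finrank_map_subtype_eq V, h5]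
  omega

/-- The dimension is at least `C(n+k+1, k+1) - C(n+k-1, k+1)`, which by Pascal's rule is at least
`C(n+k, k) ≥ n^k / k!`. For spheres of dimension `d` one has `k = d - 1`. -/
theorem pow_le_factorial_mul_finrank (k n : ℕ) (hn : 2 ≤ n) :
    n ^ k ≤ k.factorial * Module.finrank ℂ (harmonicPolynomials (k + 2) n) := by
  obtain ⟨n, rfl⟩ : ∃ l, n = l + 2 := ⟨n - 2, by omega⟩
  have h1 := le_finrank_harmonicPolynomials (k + 2) n
  rw [finrank_homogeneousSubmodule, finrank_homogeneousSubmodule] at h1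
  have e1 : (k + 2 + (n + 2) - 1).choose (n + 2) = (n + k + 3).choose (k + 1) := by
    rw [← Nat.choose_symm_of_eq_add (show n + k + 3 = (n + 2) + (k + 1) by omega)]
    congr 1; omega
  have e2 : (k + 2 + n - 1).choose n = (n + k + 1).choose (k + 1) := by
    rw [← Nat.choose_symm_of_eq_add (show n + k + 1 = n + (k + 1) by omega)]
    congr 1; omega
  have e3 := Nat.choose_succ_succ (n + k + 2) k
  have e4 : (n + k + 1).choose (k + 1) ≤ (n + k + 2).choose (k + 1) :=
    Nat.choose_le_choose _ (by omega)
  rw [e1, e2] at h1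
  simp only [Nat.succ_eq_add_one] at e3
  have h2 : (n + k + 2).choose k ≤ Module.finrank ℂ (harmonicPolynomials (k + 2) (n + 2)) := by
    have e5 : n + k + 2 + 1 = n + k + 3 := by ring
    rw [e5] at e3
    omega
  calc (n + 2) ^ k ≤ (n + k + 2 + 1 - k) ^ k := Nat.pow_le_pow_left (by omega) k
    _ ≤ (n + k + 2).descFactorial k := Nat.pow_sub_le_descFactorial _ _
    _ = k.factorial * (n + k + 2).choose k := Nat.descFactorial_eq_factorial_mul_choose _ _
    _ ≤ _ := Nat.mul_le_mul_left _ h2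

/-- The `L²` class of the restriction of a polynomial to the sphere. -/
noncomputable def toL2 (m : ℕ) : MvPolynomial (Fin m) ℂ →ₗ[ℂ] Lp ℂ 2 (sphereMeasure m) :=
  (ContinuousMap.toLp (E := ℂ) 2 (sphereMeasure m) ℂ).toLinearMap ∘ₗ restrictToSphere m

variable {m : ℕ}

theorem coeFn_toL2 (P : MvPolynomial (Fin m) ℂ) :
    toL2 m P =ᵐ[sphereMeasure m] fun x => realEval P (x : Euc m) := by
  filter_upwards [ContinuousMap.coeFn_toLp (p := 2) (𝕜 := ℂ) (sphereMeasure m)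
    (restrictToSphere m P)] with x hx
  exact hx.trans (restrictToSphere_apply m P x)

theorem realEval_eq_of_toL2_eq {P Q : MvPolynomial (Fin m) ℂ} (h : toL2 m P = toL2 m Q)
    (x : UnitSphere m) : realEval P (x : Euc m) = realEval Q (x : Euc m) := by
  have h1 : restrictToSphere m P = restrictToSphere m Q :=
    ContinuousMap.toLp_injective (p := 2) (𝕜 := ℂ) (sphereMeasure m) h
  have h2 := congrArg (fun f => f x) h1
  simp only [restrictToSphere_apply] at h2
  exact h2

theorem inner_toL2 (P Q : MvPolynomial (Fin m) ℂ) :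
    inner ℂ (toL2 m P) (toL2 m Q) =
      ∫ x : UnitSphere m, realEval Q (x : Euc m) * star (realEval P (x : Euc m))
        ∂sphereMeasure m := by
  have h := ContinuousMap.inner_toLp (𝕜 := ℂ) (sphereMeasure m)
    (restrictToSphere m P) (restrictToSphere m Q)
  refine h.trans ?_
  simp only [restrictToSphere_apply]
  rfl

/-- Homogeneity spreads the zeros from the sphere to all of `ℝ^m`, and a complex polynomial
vanishing at all real points is zero. Consequently restriction to the sphere loses no dimension. -/
theorem eq_zero_of_realEval_sphere_eq_zero (hm : 0 < m) {n : ℕ} {P : MvPolynomial (Fin m) ℂ}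
    (hP : P.IsHomogeneous n) (h : ∀ x : UnitSphere m, realEval P (x : Euc m) = 0) : P = 0 := by
  have h1 : ∀ x : Euc m, realEval P x = 0 := by
    intro x
    by_cases hx : x = 0
    · have h2 := h ⟨EuclideanSpace.single ⟨0, hm⟩ 1, by simp⟩
      rw [hx, ← zero_smul ℝ (EuclideanSpace.single (⟨0, hm⟩ : Fin m) (1 : ℝ)),
        realEval_homogeneous_smul hP, h2, mul_zero]
    · have h2 := h ⟨‖x‖⁻¹ • x, by simp [norm_smul, hx]⟩
      rw [← smul_inv_smul₀ (norm_ne_zero_iff.2 hx) x, realEval_homogeneous_smul hP, h2, mul_zero]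
  refine MvPolynomial.funext_set (fun _ => Set.range ((↑) : ℝ → ℂ))
    (fun _ => Set.infinite_range_of_injective Complex.ofReal_injective) fun z hz => ?_
  have hz' : ∀ i, ∃ r : ℝ, (r : ℂ) = z i := fun i => hz i (Set.mem_univ i)
  choose r hr using hz'
  have h2 := h1 (WithLp.toLp 2 r)
  unfold realEval at h2
  simp only [hr] at h2
  rw [map_zero, ← h2]

theorem finrank_sphericalHarmonics (d n : ℕ) :
    Module.finrank ℂ (sphericalHarmonics d n) =
      Module.finrank ℂ (harmonicPolynomials (d + 1) n) := by
  have h : sphericalHarmonics d n =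
      LinearMap.range ((toL2 (d + 1)).domRestrict (harmonicPolynomials (d + 1) n)) := by
    rw [LinearMap.range_domRestrict]; rfl
  rw [h]
  refine LinearMap.finrank_range_of_inj ?_
  rw [← LinearMap.ker_eq_bot, LinearMap.ker_eq_bot']
  intro P hP
  ext1
  refine eq_zero_of_realEval_sphere_eq_zero (Nat.succ_pos d) P.2.1 fun x => ?_
  have h1 := realEval_eq_of_toL2_eq (P := P.1) (Q := 0) (by rw [map_zero]; exact hP) x
  simpa using h1

end dimension

/-! ### The reproducing kernel -/

section kernel

/-- A polynomial representing the `i`-th element of the orthonormal basis of the spherical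
harmonics. -/
theorem exists_basisPolynomial (d n : ℕ)
    (i : Fin (Module.finrank ℂ (sphericalHarmonics d n))) :
    ∃ P ∈ harmonicPolynomials (d + 1) n,
      toL2 (d + 1) P = stdOrthonormalBasis ℂ (sphericalHarmonics d n) i :=
  (stdOrthonormalBasis ℂ (sphericalHarmonics d n) i).2

/-- Harmonic polynomials whose restrictions form the orthonormal basis of the spherical
harmonics. -/
noncomputable def basisPolynomial (d n : ℕ)
    (i : Fin (Module.finrank ℂ (sphericalHarmonics d n))) : MvPolynomial (Fin (d + 1)) ℂ :=
  (exists_basisPolynomial d n i).choose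

variable {d n : ℕ}

theorem basisPolynomial_mem (i : Fin (Module.finrank ℂ (sphericalHarmonics d n))) :
    basisPolynomial d n i ∈ harmonicPolynomials (d + 1) n :=
  (exists_basisPolynomial d n i).choose_spec.1

theorem toL2_basisPolynomial (i : Fin (Module.finrank ℂ (sphericalHarmonics d n))) :
    toL2 (d + 1) (basisPolynomial d n i) = stdOrthonormalBasis ℂ (sphericalHarmonics d n) i :=
  (exists_basisPolynomial d n i).choose_spec.2

/-- The reproducing kernel of the spherical harmonics of degree `n`, as a polynomial in the second
variable: `∑ i, star (P_i x) • P_i`. -/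
noncomputable def kernelPoly (d n : ℕ) (x : Euc (d + 1)) : MvPolynomial (Fin (d + 1)) ℂ :=
  ∑ i, star (realEval (basisPolynomial d n i) x) • basisPolynomial d n i

theorem kernelPoly_mem (x : Euc (d + 1)) : kernelPoly d n x ∈ harmonicPolynomials (d + 1) n :=
  Submodule.sum_mem _ fun i _ => Submodule.smul_mem _ _ (basisPolynomial_mem i)

theorem realEval_kernelPoly (x y : Euc (d + 1)) :
    realEval (kernelPoly d n x) y = ∑ i, star (realEval (basisPolynomial d n i) x) *
      realEval (basisPolynomial d n i) y := by
  simp [kernelPoly]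

theorem star_realEval_kernelPoly (x y : Euc (d + 1)) :
    star (realEval (kernelPoly d n x) y) = realEval (kernelPoly d n y) x := by
  rw [realEval_kernelPoly, realEval_kernelPoly, star_sum]
  exact Finset.sum_congr rfl fun i _ => by rw [star_mul, star_star]

theorem integrable_realEval_mul_star {m : ℕ} (P Q : MvPolynomial (Fin m) ℂ) :
    Integrable (fun x : UnitSphere m => realEval P (x : Euc m) * star (realEval Q (x : Euc m)))
      (sphereMeasure m) :=
  (((continuous_realEval P).mul (continuous_realEval Q).star).comp
    continuous_subtype_val).integrable_of_hasCompactSupport (HasCompactSupport.of_compactSpace _)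

/-- The reproducing property. -/
theorem integral_mul_star_kernelPoly {W : MvPolynomial (Fin (d + 1)) ℂ}
    (hW : W ∈ harmonicPolynomials (d + 1) n) (x : UnitSphere (d + 1)) :
    ∫ y : UnitSphere (d + 1), realEval W (y : Euc (d + 1)) *
      star (realEval (kernelPoly d n x) (y : Euc (d + 1))) ∂sphereMeasure (d + 1) =
      realEval W (x : Euc (d + 1)) := by
  have h2 := congrArg (Submodule.subtype _)
    ((stdOrthonormalBasis ℂ (sphericalHarmonics d n)).sum_repr' ⟨toL2 (d + 1) W, W, hW, rfl⟩)
  simp only [map_sum, map_smul, Submodule.subtype_apply, Submodule.coe_inner,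
    ← toL2_basisPolynomial] at h2
  simp only [← map_smul, ← map_sum] at h2
  rw [← realEval_eq_of_toL2_eq h2 x, realEval_sum]
  simp only [realEval_kernelPoly, star_sum, Finset.mul_sum, realEval_smul, inner_toL2]
  rw [integral_finsetSum]
  · refine Finset.sum_congr rfl fun i _ => ?_
    rw [← integral_mul_const]
    congr 1
    ext y
    rw [star_mul, star_star, mul_assoc]
  · intro i _
    refine ((integrable_realEval_mul_star W (basisPolynomial d n i)).mul_const
      (realEval (basisPolynomial d n i) (x : Euc (d + 1)))).congr
      (Filter.Eventually.of_forall fun y => ?_)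
    simp only [star_mul, star_star, mul_assoc]

/-- The reproducing property characterizes the kernel. -/
theorem realEval_eq_kernelPoly {A : MvPolynomial (Fin (d + 1)) ℂ}
    (hA : A ∈ harmonicPolynomials (d + 1) n) (x : UnitSphere (d + 1))
    (h : ∀ W ∈ harmonicPolynomials (d + 1) n,
      ∫ y : UnitSphere (d + 1), realEval W (y : Euc (d + 1)) *
        star (realEval A (y : Euc (d + 1))) ∂sphereMeasure (d + 1) = realEval W (x : Euc (d + 1)))
    (z : UnitSphere (d + 1)) :
    realEval A (z : Euc (d + 1)) = realEval (kernelPoly d n x) (z : Euc (d + 1)) := by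
  -- Pair `A` with the kernel at `z` in two ways: the kernel reproduces `A` at `z`, and `A`
  -- reproduces the kernel at `x`.
  have h1 := integral_mul_star_kernelPoly hA z
  have h2 := congrArg star (h _ (kernelPoly_mem (z : Euc (d + 1))))
  rw [star_realEval_kernelPoly] at h2
  rw [← h1, ← h2, ← starRingEnd_apply, ← integral_conj]
  congr 1
  ext y
  simp [mul_comm]

/-- The kernel is invariant under isometries. -/
theorem kernelPoly_isometry (L : Euc (d + 1) ≃ₗᵢ[ℝ] Euc (d + 1)) (x y : UnitSphere (d + 1)) :
    realEval (kernelPoly d n (L x)) (L y) = realEval (kernelPoly d n x) (y : Euc (d + 1)) := by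
  rw [← realEval_rotate]
  -- By uniqueness it is enough that the rotated kernel reproduces at `x`, which follows by the
  -- change of variables `L` on the sphere.
  refine realEval_eq_kernelPoly (rotate_mem L (kernelPoly_mem _)) x (fun W hW => ?_) y
  have h := integral_mul_star_kernelPoly (rotate_mem L.symm hW) (sphereIsometry L x)
  rw [← integral_sphereIsometry L] at h
  simpa [realEval_rotate] using h

end kernel

/-! ### Zonal form and size of the kernel -/

section zonalKernel

variable {d : ℕ}

/-- The unnormalized zonal function of degree `n`. -/
noncomputable def zonal (d : ℕ) [NeZero d] (n : ℕ) (t : ℝ) : ℂ :=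
  laplaceMean d n t (Real.sqrt (1 - t ^ 2))

/-- The pole of the sphere. -/
noncomputable def pole (d : ℕ) : UnitSphere (d + 1) :=
  ⟨EuclideanSpace.single 0 1, by simp⟩

theorem coe_pole_eq_consVec : (pole d : Euc (d + 1)) = consVec 1 0 := by
  ext i
  refine Fin.cases ?_ (fun i => ?_) i <;> simp [pole]

/-- The value of the reproducing kernel on the diagonal. -/
noncomputable def kernelDiag (d n : ℕ) : ℂ :=
  realEval (kernelPoly d n (pole d)) (pole d : Euc (d + 1))

theorem kernelPoly_self {n : ℕ} (x : UnitSphere (d + 1)) :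
    realEval (kernelPoly d n x) (x : Euc (d + 1)) = kernelDiag d n := by
  obtain ⟨L, hL⟩ := exists_isometry_map_eq (v := (pole d : Euc (d + 1))) (w := x) (by simp)
  rw [← hL, kernelPoly_isometry, kernelDiag]

theorem harmonicProj_ae_eq_kernel {n : ℕ} {F : UnitSphere (d + 1) → ℂ}
    (hF : Integrable F (sphereMeasure (d + 1))) :
    harmonicProj d n F =ᵐ[sphereMeasure (d + 1)] fun x =>
      ∫ y : UnitSphere (d + 1), F y * realEval (kernelPoly d n y) (x : Euc (d + 1))
        ∂sphereMeasure (d + 1) := by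
  have hae : ∀ i, (stdOrthonormalBasis ℂ (sphericalHarmonics d n) i :
      Lp ℂ 2 (sphereMeasure (d + 1))) =ᵐ[sphereMeasure (d + 1)]
        fun x => realEval (basisPolynomial d n i) (x : Euc (d + 1)) := by
    intro i
    rw [← toL2_basisPolynomial]
    exact coeFn_toL2 _
  have hint : ∀ i, Integrable (fun y : UnitSphere (d + 1) =>
      F y * star (realEval (basisPolynomial d n i) (y : Euc (d + 1)))) (sphereMeasure (d + 1)) := by
    intro i
    refine (integrable_mul_star_of_mem d n hF (Subtype.mem
      (stdOrthonormalBasis ℂ (sphericalHarmonics d n) i))).congr ?_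
    filter_upwards [hae i] with y hy
    rw [hy]
  have hcoef : ∀ i, ∫ y, F y * star ((stdOrthonormalBasis ℂ (sphericalHarmonics d n) i :
      Lp ℂ 2 (sphereMeasure (d + 1))) y) ∂sphereMeasure (d + 1) =
      ∫ y : UnitSphere (d + 1), F y * star (realEval (basisPolynomial d n i) (y : Euc (d + 1)))
        ∂sphereMeasure (d + 1) := by
    intro i
    refine integral_congr_ae ?_
    filter_upwards [hae i] with y hy
    rw [hy]
  unfold harmonicProj
  simp only [hcoef]
  simp only [← toL2_basisPolynomial, ← map_smul, ← map_sum]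
  refine (coeFn_toL2 _).trans (Filter.Eventually.of_forall fun x => ?_)
  simp only [realEval_sum, realEval_smul, realEval_kernelPoly, Finset.mul_sum]
  rw [integral_finsetSum]
  · refine Finset.sum_congr rfl fun i _ => ?_
    rw [← integral_mul_const]
    simp only [mul_assoc]
  · intro i _
    simpa only [mul_assoc] using (hint i).mul_const _

variable [NeZero d]

/-- The trace in two ways: the kernel is constant on the diagonal, and there it equals `∑ |Y_i|²`,
whose integral counts the basis. -/
theorem measureReal_mul_kernelDiag (d n : ℕ) [NeZero d] :
    ((sphereMeasure (d + 1)).real Set.univ : ℂ) * kernelDiag d n =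
      Module.finrank ℂ (harmonicPolynomials (d + 1) n) := by
  have h1 : ∫ x : UnitSphere (d + 1), realEval (kernelPoly d n x) (x : Euc (d + 1))
      ∂sphereMeasure (d + 1) = Module.finrank ℂ (harmonicPolynomials (d + 1) n) := by
    simp only [realEval_kernelPoly]
    rw [integral_finsetSum]
    · rw [← finrank_sphericalHarmonics]
      have h2 : ∀ i, ∫ x : UnitSphere (d + 1), star (realEval (basisPolynomial d n i) x) *
          realEval (basisPolynomial d n i) (x : Euc (d + 1)) ∂sphereMeasure (d + 1) = 1 := by
        intro i
        simp only [mul_comm (star _)]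
        rw [← inner_toL2, toL2_basisPolynomial, ← Submodule.coe_inner,
          (stdOrthonormalBasis ℂ (sphericalHarmonics d n)).inner_eq_one]
      rw [Finset.sum_congr rfl fun i _ => h2 i]
      simp
    · intro i _
      simp only [mul_comm (star _)]
      exact integrable_realEval_mul_star _ _
  simp only [kernelPoly_self] at h1
  rw [← h1]
  simp

/-- Isometries fixing the pole preserve the kernel at the pole, so it is constant on each parallel;
its mean there is given by Laplace's formula. -/
theorem kernelPoly_pole {n : ℕ} (y : UnitSphere (d + 1)) :
    ((sphereMeasure d).real Set.univ : ℂ) * realEval (kernelPoly d n (pole d)) (y : Euc (d + 1)) =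
      kernelDiag d n * zonal d n ((y : Euc (d + 1)) 0) := by
  have h := integral_slice_eq (kernelPoly_mem (d := d) (n := n) (pole d))
    ((y : Euc (d + 1)) 0) (Real.sqrt (1 - (y : Euc (d + 1)) 0 ^ 2))
  rw [← coe_pole_eq_consVec] at h
  rw [kernelDiag, zonal, ← h]
  have hy : ‖(y : Euc (d + 1))‖ = 1 := by simp
  have hy2 : (y : Euc (d + 1)) 0 ^ 2 ≤ 1 := by
    have h1 := PiLp.norm_apply_le (y : Euc (d + 1)) 0
    rw [hy] at h1
    rwa [sq_le_one_iff_abs_le_one]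
  have hconst : ∀ η : UnitSphere d, realEval (kernelPoly d n (pole d))
      (consVec ((y : Euc (d + 1)) 0) (Real.sqrt (1 - (y : Euc (d + 1)) 0 ^ 2) • (η : Euc d))) =
      realEval (kernelPoly d n (pole d)) (y : Euc (d + 1)) := by
    intro η
    set z : Euc (d + 1) := consVec ((y : Euc (d + 1)) 0)
      (Real.sqrt (1 - (y : Euc (d + 1)) 0 ^ 2) • (η : Euc d)) with hz
    have hη : ∑ i, (η : Euc d) i ^ 2 = 1 := by
      have h1 : ‖(η : Euc d)‖ = 1 := by simp
      rw [← EuclideanSpace.real_norm_sq_eq, h1, one_pow]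
    have hzn : ‖z‖ = 1 := by
      have h1 : ‖z‖ ^ 2 = 1 := by
        rw [EuclideanSpace.real_norm_sq_eq, Fin.sum_univ_succ]
        simp only [hz, consVec_zero, consVec_succ, PiLp.smul_apply, smul_eq_mul, mul_pow,
          Real.sq_sqrt (sub_nonneg.2 hy2)]
        rw [← Finset.mul_sum, hη]
        ring
      rwa [pow_eq_one_iff_of_nonneg (norm_nonneg z) two_ne_zero] at h1
    -- This reflection exchanges `z` and `y`. It fixes the pole because the two points have the same
    -- first coordinate.
    set L := (ℝ ∙ (z - (y : Euc (d + 1))))ᗮ.reflection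
    have hLz : L z = y := Submodule.reflection_sub (by rw [hzn, hy])
    have hLp : L (pole d : Euc (d + 1)) = pole d := by
      rw [Submodule.reflection_eq_self_iff, Submodule.mem_orthogonal_singleton_iff_inner_left]
      simp [pole, EuclideanSpace.inner_single_left, hz]
    have h1 := kernelPoly_isometry (n := n) L (pole d) ⟨z, by simpa using hzn⟩
    rw [hLp] at h1
    simp only [hLz] at h1
    exact h1.symm
  simp only [hconst]
  simp

/-- The reproducing kernel is zonal. -/
theorem kernelPoly_eq_zonal {n : ℕ} (x y : UnitSphere (d + 1)) :
    ((sphereMeasure d).real Set.univ : ℂ) * realEval (kernelPoly d n x) (y : Euc (d + 1)) =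
      kernelDiag d n * zonal d n (inner ℝ (x : Euc (d + 1)) (y : Euc (d + 1))) := by
  obtain ⟨L, hL⟩ := exists_isometry_map_eq (v := (pole d : Euc (d + 1))) (w := x) (by simp)
  have h1 := kernelPoly_isometry (n := n) L (pole d) ((sphereIsometry L).symm y)
  have h2 : L ((sphereIsometry L).symm y : UnitSphere (d + 1)) = (y : Euc (d + 1)) :=
    L.apply_symm_apply y
  rw [h2, hL] at h1
  rw [h1, kernelPoly_pole, ← hL, ← h2, L.inner_map_map]
  simp [pole, EuclideanSpace.inner_single_left]

theorem measureReal_sphere_ne_zero (d : ℕ) [NeZero d] :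
    (sphereMeasure d).real Set.univ ≠ 0 := by
  have : Nonempty (Fin d) := ⟨0⟩
  rw [measureReal_ne_zero_iff]
  simp [IsOpen.measure_ne_zero, NeZero.ne d]

/-- The projection to the spherical harmonics as an operator with zonal kernel. -/
theorem harmonicProj_ae_eq_zonal {n : ℕ} {F : UnitSphere (d + 1) → ℂ}
    (hF : Integrable F (sphereMeasure (d + 1))) :
    harmonicProj d n F =ᵐ[sphereMeasure (d + 1)] fun x =>
      (kernelDiag d n / (sphereMeasure d).real Set.univ) *
        ∫ y : UnitSphere (d + 1), F y * zonal d n (inner ℝ (y : Euc (d + 1)) (x : Euc (d + 1)))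
          ∂sphereMeasure (d + 1) := by
  have hs : ((sphereMeasure d).real Set.univ : ℂ) ≠ 0 :=
    Complex.ofReal_ne_zero.2 (measureReal_sphere_ne_zero d)
  refine (harmonicProj_ae_eq_kernel hF).trans (Filter.Eventually.of_forall fun x => ?_)
  simp only
  rw [← integral_const_mul]
  congr 1
  ext y
  have h := kernelPoly_eq_zonal (n := n) y x
  rw [mul_comm, ← eq_div_iff hs] at h
  rw [h]
  ring

/-- The diagonal of the kernel grows at least like `n ^ (d - 1)`. -/
theorem exists_le_norm_kernelDiag (d : ℕ) [NeZero d] :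
    ∃ c : ℝ, 0 < c ∧ ∀ n : ℕ, 2 ≤ n →
      c * (n : ℝ) ^ (d - 1) ≤ ‖kernelDiag d n / ((sphereMeasure d).real Set.univ : ℂ)‖ := by
  obtain ⟨k, rfl⟩ : ∃ k, d = k + 1 := ⟨d - 1, (Nat.succ_pred_eq_of_ne_zero (NeZero.ne d)).symm⟩
  have hA : 0 < (sphereMeasure (k + 1)).real Set.univ :=
    lt_of_le_of_ne measureReal_nonneg (measureReal_sphere_ne_zero _).symm
  have hB : 0 < (sphereMeasure (k + 1 + 1)).real Set.univ :=
    lt_of_le_of_ne measureReal_nonneg (measureReal_sphere_ne_zero _).symm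
  set A := (sphereMeasure (k + 1)).real Set.univ
  set B := (sphereMeasure (k + 1 + 1)).real Set.univ
  have hk : (0 : ℝ) < k.factorial := by exact_mod_cast k.factorial_pos
  refine ⟨(k.factorial * A * B)⁻¹, by positivity, fun n hn => ?_⟩
  have h1 : B * ‖kernelDiag (k + 1) n‖ =
      Module.finrank ℂ (harmonicPolynomials (k + 1 + 1) n) := by
    have h := congrArg norm (measureReal_mul_kernelDiag (k + 1) n)
    rwa [norm_mul, Complex.norm_real, Real.norm_of_nonneg hB.le, Complex.norm_natCast] at h
  have h2 : (n : ℝ) ^ k ≤ k.factorial * Module.finrank ℂ (harmonicPolynomials (k + 1 + 1) n) := by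
    exact_mod_cast pow_le_factorial_mul_finrank k n hn
  rw [← h1] at h2
  rw [norm_div, Complex.norm_real, Real.norm_of_nonneg hA.le, le_div_iff₀ hA,
    Nat.add_sub_cancel]
  calc (k.factorial * A * B)⁻¹ * (n : ℝ) ^ k * A = (n : ℝ) ^ k / (k.factorial * B) := by field_simp
    _ ≤ _ := by
      rw [div_le_iff₀ (by positivity)]
      linarith

end zonalKernel

/-! ### Central projection and its Jacobian -/

section gnomonic

variable {d : ℕ}

theorem measurePreserving_consVec :
    MeasurePreserving (fun z : ℝ × Euc d => consVec z.1 z.2) (volume.prod volume) volume := by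
  have h1 := (EuclideanSpace.volume_preserving_symm_measurableEquiv_toLp (Fin (d + 1))).symm
  have h2 := (volume_preserving_piFinSuccAbove (fun _ : Fin (d + 1) => ℝ) 0).symm
  have h3 := (MeasurePreserving.id (volume : Measure ℝ)).prod
    (EuclideanSpace.volume_preserving_symm_measurableEquiv_toLp (Fin d))
  have h4 := h1.comp (h2.comp h3)
  have h5 : (fun z : ℝ × Euc d => consVec z.1 z.2) =
      (MeasurableEquiv.toLp 2 (Fin (d + 1) → ℝ)).symm.symm ∘
      (MeasurableEquiv.piFinSuccAbove (fun _ : Fin (d + 1) => ℝ) 0).symm ∘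
      Prod.map id (MeasurableEquiv.toLp 2 (Fin d → ℝ)).symm := by
    ext z i
    refine Fin.cases ?_ (fun i => ?_) i <;> simp [consVec, MeasurableEquiv.piFinSuccAbove]
  rw [h5]
  exact h4

theorem continuous_consVec : Continuous (fun z : ℝ × Euc d => consVec z.1 z.2) := by
  unfold consVec
  refine (PiLp.continuous_toLp 2 _).comp (continuous_pi fun i => ?_)
  refine Fin.cases ?_ (fun i => ?_) i
  · simpa using continuous_fst
  · simp only [Fin.cons_succ]; fun_prop

theorem norm_consVec_sq (t : ℝ) (x : Euc d) : ‖consVec t x‖ ^ 2 = t ^ 2 + ‖x‖ ^ 2 := by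
  rw [EuclideanSpace.real_norm_sq_eq, Fin.sum_univ_succ, EuclideanSpace.real_norm_sq_eq]
  simp

theorem inner_consVec (s t : ℝ) (x y : Euc d) :
    inner ℝ (consVec s x) (consVec t y) = s * t + inner ℝ x y := by
  simp [PiLp.inner_apply, Fin.sum_univ_succ, mul_comm]

theorem norm_consVec_one_pos (x : Euc d) : 0 < ‖consVec 1 x‖ := by
  have h := norm_consVec_sq 1 x
  rw [norm_pos_iff]
  rintro h0
  rw [h0, norm_zero] at h
  nlinarith [sq_nonneg ‖x‖]

/-- The central projection of the tangent space at the pole to the sphere. -/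
noncomputable def gnomonic (x : Euc d) : UnitSphere (d + 1) :=
  ⟨‖consVec 1 x‖⁻¹ • consVec 1 x, by
    rw [mem_sphere_zero_iff_norm, norm_smul, norm_inv, norm_norm,
      inv_mul_cancel₀ (norm_consVec_one_pos x).ne']⟩

theorem continuous_gnomonic : Continuous (gnomonic : Euc d → UnitSphere (d + 1)) := by
  have h : Continuous (fun x : Euc d => consVec 1 x) :=
    continuous_consVec.comp (Continuous.prodMk continuous_const continuous_id)
  refine Continuous.subtype_mk (Continuous.smul (h.norm.inv₀ fun x => ?_) h) _
  exact (norm_consVec_one_pos x).ne'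

theorem gnomonic_zero (x : Euc d) : (gnomonic x : Euc (d + 1)) 0 = ‖consVec 1 x‖⁻¹ := by
  simp [gnomonic]

theorem gnomonic_zero_pos (x : Euc d) : 0 < (gnomonic x : Euc (d + 1)) 0 := by
  rw [gnomonic_zero]
  exact inv_pos.2 (norm_consVec_one_pos x)

/-- The inverse of the central projection. -/
noncomputable def gnomonicInv (z : Euc (d + 1)) : Euc d :=
  (z 0)⁻¹ • WithLp.toLp 2 (fun i => z i.succ)

theorem measurable_gnomonicInv : Measurable (gnomonicInv : Euc (d + 1) → Euc d) := by
  unfold gnomonicInv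
  refine Measurable.smul (f := fun z : Euc (d + 1) => (z 0)⁻¹) (by fun_prop) ?_
  exact Continuous.measurable (by fun_prop)

theorem gnomonicInv_consVec (t : ℝ) (x : Euc d) : gnomonicInv (consVec t x) = t⁻¹ • x := by
  ext i; simp [gnomonicInv]

theorem gnomonicInv_smul {r : ℝ} (hr : r ≠ 0) (z : Euc (d + 1)) :
    gnomonicInv (r • z) = gnomonicInv z := by
  ext i; simp [gnomonicInv]; field_simp

theorem gnomonicInv_gnomonic (x : Euc d) : gnomonicInv (gnomonic x : Euc (d + 1)) = x := by
  rw [gnomonic, gnomonicInv_smul (inv_ne_zero (norm_consVec_one_pos x).ne'), gnomonicInv_consVec]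
  simp

theorem gnomonic_gnomonicInv {ω : UnitSphere (d + 1)} (hω : 0 < (ω : Euc (d + 1)) 0) :
    gnomonic (gnomonicInv (ω : Euc (d + 1))) = ω := by
  have h1 : consVec 1 (gnomonicInv (ω : Euc (d + 1))) =
      ((ω : Euc (d + 1)) 0)⁻¹ • (ω : Euc (d + 1)) := by
    ext i
    refine Fin.cases ?_ (fun i => ?_) i
    · simp [hω.ne']
    · simp [gnomonicInv]
  ext1
  simp only [gnomonic, h1]
  rw [norm_smul, norm_inv, Real.norm_of_nonneg hω.le, norm_eq_of_mem_sphere, mul_one, inv_inv,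
    smul_inv_smul₀ hω.ne']

theorem lintegral_Ioo_pow (n : ℕ) {a : ℝ} (ha : 0 < a) :
    ∫⁻ r in Set.Ioo 0 a, ENNReal.ofReal (r ^ n) = ENNReal.ofReal (a ^ (n + 1) / (n + 1)) := by
  rw [Measure.restrict_congr_set Ioo_ae_eq_Ioc,
    ← ofReal_integral_eq_lintegral_ofReal
      (intervalIntegral.intervalIntegrable_pow n).1,
    ← intervalIntegral.integral_of_le ha.le]
  · simp
  · filter_upwards [ae_restrict_mem measurableSet_Ioc] with y hy
    exact pow_nonneg hy.1.le _

theorem lintegral_comp_inv_smul {t : ℝ} (ht : 0 < t) {f : Euc d → ENNReal} (hf : Measurable f) :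
    ∫⁻ x, f (t⁻¹ • x) = ENNReal.ofReal (t ^ d) * ∫⁻ x, f x := by
  have h := Measure.map_addHaar_smul (volume : Measure (Euc d)) (inv_ne_zero ht.ne')
  rw [finrank_euclideanSpace_fin] at h
  rw [← lintegral_map hf (measurable_const_smul t⁻¹), h, lintegral_smul_measure, inv_pow, inv_inv,
    abs_of_pos (pow_pos ht d), smul_eq_mul]

/-- The open upper half sphere. -/
def upperHalf (d : ℕ) : Set (UnitSphere (d + 1)) := {ω | 0 < (ω : Euc (d + 1)) 0}

theorem measurableSet_upperHalf : MeasurableSet (upperHalf d) :=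
  measurableSet_lt measurable_const (by fun_prop)

/-- The density of the image of Lebesgue measure under the central projection. -/
noncomputable def gnomonicDensity (ω : UnitSphere (d + 1)) : ENNReal :=
  ENNReal.ofReal (((ω : Euc (d + 1)) 0)⁻¹ ^ (d + 1))

theorem measurable_gnomonicDensity :
    Measurable (gnomonicDensity : UnitSphere (d + 1) → ENNReal) := by
  unfold gnomonicDensity
  have : Measurable fun ω : UnitSphere (d + 1) => (ω : Euc (d + 1)) 0 :=
    Continuous.measurable (by fun_prop)
  fun_prop

/-- Integrate the radially constant extension of `h` over the slab `0 < z₀ < 1` in two ways. The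
slice at height `t` is a dilate of the tangent plane and contributes `t^d`; the ray through `ω`
leaves the slab at `r = 1/ω₀` and contributes `ω₀^(-(d+1))/(d+1)`. Comparison yields the density
without differentiating the map. -/
theorem lintegral_gnomonic {h : UnitSphere (d + 1) → ENNReal} (hh : Measurable h) :
    ∫⁻ x, h (gnomonic x) = ∫⁻ ω in upperHalf d, gnomonicDensity ω * h ω ∂sphereMeasure (d + 1) := by
  have hh' : Measurable (fun x : Euc d => h (gnomonic x)) := hh.comp continuous_gnomonic.measurable
  set S : Set (Euc (d + 1)) := {z | z 0 ∈ Set.Ioo (0 : ℝ) 1} with hS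
  have hSm : MeasurableSet S := by
    have : Measurable fun z : Euc (d + 1) => z 0 := by fun_prop
    exact this measurableSet_Ioo
  set g : Euc (d + 1) → ENNReal := S.indicator fun z => h (gnomonic (gnomonicInv z)) with hg
  have hgm : Measurable g := (hh'.comp measurable_gnomonicInv).indicator hSm
  have hd0 : ENNReal.ofReal (1 / ((d : ℝ) + 1)) ≠ 0 := by
    rw [ENNReal.ofReal_ne_zero_iff]; positivity
  have h1 : ∫⁻ z, g z = ENNReal.ofReal (1 / ((d : ℝ) + 1)) * ∫⁻ x, h (gnomonic x) := by
    have hgm' : Measurable fun z : ℝ × Euc d => g (consVec z.1 z.2) :=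
      hgm.comp continuous_consVec.measurable
    rw [← measurePreserving_consVec.lintegral_comp hgm, lintegral_prod _ hgm'.aemeasurable]
    have h2 : ∀ t : ℝ, ∫⁻ x : Euc d, g (consVec t x) = (Set.Ioo (0 : ℝ) 1).indicator
        (fun t => ENNReal.ofReal (t ^ d) * ∫⁻ x, h (gnomonic x)) t := by
      intro t
      by_cases ht : t ∈ Set.Ioo (0 : ℝ) 1
      · have h3 : ∀ x : Euc d, g (consVec t x) = h (gnomonic (t⁻¹ • x)) := by
          intro x
          have : consVec t x ∈ S := by simpa [hS] using ht
          rw [hg, Set.indicator_of_mem this, gnomonicInv_consVec]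
        simp only [h3]
        rw [Set.indicator_of_mem ht, lintegral_comp_inv_smul ht.1 hh']
      · have h3 : ∀ x : Euc d, g (consVec t x) = 0 := by
          intro x
          have : consVec t x ∉ S := by simpa [hS] using ht
          rw [hg, Set.indicator_of_notMem this]
        simp only [h3]
        rw [Set.indicator_of_notMem ht, lintegral_zero]
    simp only [h2]
    rw [lintegral_indicator measurableSet_Ioo, lintegral_mul_const _ (by fun_prop),
      lintegral_Ioo_pow d one_pos, one_pow]
  have h2 : ∫⁻ z, g z = ENNReal.ofReal (1 / ((d : ℝ) + 1)) *
      ∫⁻ ω in upperHalf d, gnomonicDensity ω * h ω ∂sphereMeasure (d + 1) := by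
    have hm : Measurable fun ω => gnomonicDensity ω * h ω := measurable_gnomonicDensity.mul hh
    rw [lintegral_eq_lintegral_sphere hgm, ← lintegral_const_mul _ hm, ← lintegral_indicator measurableSet_upperHalf]
    refine lintegral_congr fun ω => ?_
    by_cases hω : ω ∈ upperHalf d
    · have hω' : 0 < (ω : Euc (d + 1)) 0 := hω
      rw [Set.indicator_of_mem hω]
      have h3 : ∀ r ∈ Set.Ioi (0 : ℝ), ENNReal.ofReal (r ^ (d + 1 - 1)) * g (r • (ω : Euc (d + 1))) =
          (Set.Ioo 0 ((ω : Euc (d + 1)) 0)⁻¹).indicator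
            (fun r => ENNReal.ofReal (r ^ d) * h ω) r := by
        intro r hr
        have hr' : 0 < r := hr
        by_cases hr2 : r < ((ω : Euc (d + 1)) 0)⁻¹
        · have hmem : r • (ω : Euc (d + 1)) ∈ S := by
            rw [lt_inv_comm₀ hr' hω', inv_eq_one_div, lt_div_iff₀ hr', mul_comm] at hr2
            exact ⟨by simpa using mul_pos hr' hω', by simpa using hr2⟩
          rw [Set.indicator_of_mem (show r ∈ Set.Ioo 0 _ from ⟨hr', hr2⟩), hg, Set.indicator_of_mem hmem,
            gnomonicInv_smul hr'.ne', gnomonic_gnomonicInv hω', Nat.add_sub_cancel]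
        · have hmem : r • (ω : Euc (d + 1)) ∉ S := by
            rintro ⟨-, h4⟩
            refine hr2 ?_
            rw [lt_inv_comm₀ hr' hω', inv_eq_one_div, lt_div_iff₀ hr', mul_comm]
            simpa using h4
          rw [Set.indicator_of_notMem fun h4 => hr2 h4.2, hg, Set.indicator_of_notMem hmem, mul_zero]
      rw [setLIntegral_congr_fun measurableSet_Ioi h3, setLIntegral_indicator measurableSet_Ioo,
        Set.inter_eq_left.2 (fun r hr => hr.1), lintegral_mul_const _ (by fun_prop),
        lintegral_Ioo_pow d (inv_pos.2 hω'), gnomonicDensity, ← mul_assoc,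
        ← ENNReal.ofReal_mul (by positivity)]
      congr 2
      ring
    · rw [Set.indicator_of_notMem hω]
      rw [setLIntegral_congr_fun (g := fun _ => 0) measurableSet_Ioi, lintegral_zero]
      intro r hr
      have hmem : r • (ω : Euc (d + 1)) ∉ S := by
        rintro ⟨h4, -⟩
        refine hω ?_
        have h5 : 0 < r * (ω : Euc (d + 1)) 0 := by simpa using h4
        exact pos_of_mul_pos_right h5 (le_of_lt hr)
      simp only [hg, Set.indicator_of_notMem hmem, mul_zero]
  rw [h1] at h2
  exact (ENNReal.mul_right_inj hd0 ENNReal.ofReal_ne_top).1 h2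

theorem map_gnomonic : Measure.map gnomonic (volume : Measure (Euc d)) =
    ((sphereMeasure (d + 1)).restrict (upperHalf d)).withDensity gnomonicDensity := by
  ext s hs
  rw [← lintegral_indicator_one hs, lintegral_map (measurable_one.indicator hs)
    continuous_gnomonic.measurable, lintegral_gnomonic (measurable_one.indicator hs),
    withDensity_apply _ hs, ← lintegral_indicator hs]
  refine lintegral_congr fun ω => ?_
  by_cases h : ω ∈ s <;> simp [h]

theorem sphere_coord_le_one (ω : UnitSphere (d + 1)) : (ω : Euc (d + 1)) 0 ≤ 1 := by
  have h1 := PiLp.norm_apply_le (ω : Euc (d + 1)) 0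
  rw [norm_eq_of_mem_sphere] at h1
  exact (le_abs_self _).trans h1

/-- The density `ω₀^(-(d+1))` is at least `1` because `ω₀ ≤ 1`. -/
theorem restrict_upperHalf_le :
    (sphereMeasure (d + 1)).restrict (upperHalf d) ≤ Measure.map gnomonic volume := by
  rw [map_gnomonic]
  refine Measure.le_intro fun s hs _ => ?_
  rw [withDensity_apply _ hs, ← setLIntegral_one]
  refine lintegral_mono_ae ?_
  filter_upwards [ae_restrict_of_ae (ae_restrict_mem measurableSet_upperHalf)] with ω hω
  rw [gnomonicDensity, ENNReal.one_le_ofReal]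
  exact one_le_pow₀ ((one_le_inv₀ hω).2 (sphere_coord_le_one ω))

theorem inv_gnomonic_zero_le {x : Euc d} (hx : x ∈ Metric.ball (0 : Euc d) 1) :
    ((gnomonic x : Euc (d + 1)) 0)⁻¹ ≤ 2 := by
  rw [gnomonic_zero, inv_inv]
  have h1 := norm_consVec_sq 1 x
  have h2 : ‖x‖ < 1 := by simpa using hx
  nlinarith [norm_nonneg x, norm_nonneg (consVec 1 x)]

/-- Over the unit ball `1/ω₀ = |(1, x)| ≤ 2`, which bounds the density from above; this is why
functions are localized to the unit ball. -/
theorem map_gnomonic_restrict_ball_le :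
    Measure.map gnomonic ((volume : Measure (Euc d)).restrict (Metric.ball 0 1)) ≤
      (2 ^ (d + 1) : ENNReal) • sphereMeasure (d + 1) := by
  refine Measure.le_intro fun s hs _ => ?_
  set T : Set (UnitSphere (d + 1)) := {ω | ((ω : Euc (d + 1)) 0)⁻¹ ≤ 2} with hT
  have hTm : MeasurableSet T := by
    have : Measurable fun ω : UnitSphere (d + 1) => (ω : Euc (d + 1)) 0 :=
      Continuous.measurable (by fun_prop)
    exact measurableSet_le this.inv measurable_const
  have h1 : Measure.map gnomonic ((volume : Measure (Euc d)).restrict (Metric.ball 0 1)) s ≤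
      Measure.map gnomonic (volume : Measure (Euc d)) (s ∩ T) := by
    rw [Measure.map_apply continuous_gnomonic.measurable hs,
      Measure.map_apply continuous_gnomonic.measurable (hs.inter hTm),
      Measure.restrict_apply (continuous_gnomonic.measurable hs)]
    exact measure_mono fun x hx => ⟨hx.1, inv_gnomonic_zero_le hx.2⟩
  refine h1.trans ?_
  rw [map_gnomonic, withDensity_apply _ (hs.inter hTm)]
  calc ∫⁻ ω in s ∩ T, gnomonicDensity ω ∂(sphereMeasure (d + 1)).restrict (upperHalf d)
      ≤ ∫⁻ ω in s ∩ T, 2 ^ (d + 1) ∂(sphereMeasure (d + 1)).restrict (upperHalf d) := by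
        refine lintegral_mono_ae ?_
        filter_upwards [ae_restrict_mem (hs.inter hTm),
          ae_restrict_of_ae (ae_restrict_mem measurableSet_upperHalf)] with ω hω hω2
        have hω3 : ((ω : Euc (d + 1)) 0)⁻¹ ≤ 2 := hω.2
        have hω4 : 0 < (ω : Euc (d + 1)) 0 := hω2
        have h2 : (2 : ENNReal) ^ (d + 1) = ENNReal.ofReal (2 ^ (d + 1)) := by
          rw [ENNReal.ofReal_pow (by norm_num)]; simp
        rw [gnomonicDensity, h2]
        gcongr
    _ = 2 ^ (d + 1) * ((sphereMeasure (d + 1)).restrict (upperHalf d)) (s ∩ T) := by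
      rw [setLIntegral_const]
    _ ≤ 2 ^ (d + 1) * sphereMeasure (d + 1) s := by
      gcongr
      · exact Measure.restrict_le_self
      · exact Set.inter_subset_left
    _ = _ := by rw [Measure.smul_apply, smul_eq_mul]

theorem integral_gnomonic {h : UnitSphere (d + 1) → ℂ} (hh : Measurable h) :
    ∫ x, h (gnomonic x) = ∫ ω in upperHalf d,
      (((ω : Euc (d + 1)) 0)⁻¹ ^ (d + 1) : ℝ) • h ω ∂sphereMeasure (d + 1) := by
  rw [← integral_map continuous_gnomonic.aemeasurable hh.aestronglyMeasurable, map_gnomonic,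
    integral_withDensity_eq_integral_toReal_smul measurable_gnomonicDensity
      (Filter.Eventually.of_forall fun ω => ENNReal.ofReal_lt_top)]
  refine setIntegral_congr_fun measurableSet_upperHalf fun ω hω => ?_
  have hω' : 0 < (ω : Euc (d + 1)) 0 := hω
  simp only [gnomonicDensity]
  rw [ENNReal.toReal_ofReal (by positivity)]

end gnomonic

/-! ### Homogeneity of the operator norm bound -/

section projNorm

variable {d n : ℕ} {p q : ENNReal}

theorem harmonicProj_congr {F G : UnitSphere (d + 1) → ℂ} (h : F =ᵐ[sphereMeasure (d + 1)] G) :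
    harmonicProj d n F = harmonicProj d n G := by
  unfold harmonicProj
  refine Finset.sum_congr rfl fun i _ => ?_
  congr 1
  refine integral_congr_ae ?_
  filter_upwards [h] with x hx
  rw [hx]

theorem harmonicProj_smul (a : ℂ) (F : UnitSphere (d + 1) → ℂ) :
    harmonicProj d n (a • F) = a • harmonicProj d n F := by
  unfold harmonicProj
  rw [Finset.smul_sum]
  refine Finset.sum_congr rfl fun i _ => ?_
  rw [smul_smul, ← integral_const_mul]
  simp [mul_assoc]

/-- The operator norm controls the projection of an arbitrary function. -/
theorem eLpNorm_harmonicProj_le (hp : p ≠ 0) {F : UnitSphere (d + 1) → ℂ}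
    (hF : MemLp F p (sphereMeasure (d + 1))) :
    eLpNorm (harmonicProj d n F) q (sphereMeasure (d + 1)) ≤
      projNorm d n p q * eLpNorm F p (sphereMeasure (d + 1)) := by
  set N := eLpNorm F p (sphereMeasure (d + 1)) with hN
  have hNtop : N ≠ ⊤ := hF.2.ne
  -- Normalizing by `N` needs `N ≠ 0`; otherwise the function vanishes almost everywhere, and so
  -- does its projection.
  by_cases h0 : N = 0
  · have h1 : F =ᵐ[sphereMeasure (d + 1)] (0 : ℂ) • F := by
      rw [hN, eLpNorm_eq_zero_iff hF.1 hp] at h0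
      filter_upwards [h0] with x hx
      simp [hx]
    rw [harmonicProj_congr h1, harmonicProj_smul, zero_smul, eLpNorm_congr_ae (Lp.coeFn_zero ..)]
    simp
  · have hNr : 0 < N.toReal := ENNReal.toReal_pos h0 hNtop
    set a : ℂ := ((N.toReal : ℝ) : ℂ)⁻¹ with ha
    have ha0 : a ≠ 0 := inv_ne_zero (Complex.ofReal_ne_zero.2 hNr.ne')
    have hae : ‖a‖ₑ = N⁻¹ := by
      rw [ha, enorm_inv (Complex.ofReal_ne_zero.2 hNr.ne'), ← ofReal_norm, Complex.norm_real,
        Real.norm_of_nonneg hNr.le, ENNReal.ofReal_toReal hNtop]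
    have h1 : eLpNorm (a • F) p (sphereMeasure (d + 1)) ≤ 1 := by
      rw [eLpNorm_const_smul, hae, ← hN, ENNReal.inv_mul_cancel h0 hNtop]
    have h2 : eLpNorm (harmonicProj d n (a • F)) q (sphereMeasure (d + 1)) ≤ projNorm d n p q := by
      unfold projNorm
      exact le_iSup_of_le (a • F) (le_iSup_of_le (hF.const_smul a) (le_iSup_of_le h1 le_rfl))
    rw [harmonicProj_smul, eLpNorm_congr_ae (Lp.coeFn_smul _ _), eLpNorm_const_smul, hae] at h2
    calc _ = N * (N⁻¹ * eLpNorm (harmonicProj d n F) q (sphereMeasure (d + 1))) := by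
          rw [← mul_assoc, ENNReal.mul_inv_cancel h0 hNtop, one_mul]
      _ ≤ N * projNorm d n p q := by gcongr
      _ = _ := mul_comm _ _

end projNorm

/-! ### Transplantation between the tangent space and the sphere -/

section transplant

variable {d : ℕ}

/-- Transplantation of a function from the tangent space at the pole to the sphere. -/
noncomputable def transplant (g : Euc d → ℂ) : UnitSphere (d + 1) → ℂ :=
  (upperHalf d).indicator fun ω =>
    (((ω : Euc (d + 1)) 0)⁻¹ ^ (d + 1) : ℝ) • g (gnomonicInv (ω : Euc (d + 1)))

theorem measurable_transplant {g : Euc d → ℂ} (hg : Measurable g) : Measurable (transplant g) := by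
  refine Measurable.indicator ?_ measurableSet_upperHalf
  have h1 : Measurable fun ω : UnitSphere (d + 1) => (ω : Euc (d + 1)) 0 :=
    Continuous.measurable (by fun_prop)
  exact (h1.inv.pow_const _).smul (hg.comp (measurable_gnomonicInv.comp measurable_subtype_coe))

theorem transplant_gnomonic (g : Euc d → ℂ) (x : Euc d) :
    transplant g (gnomonic x) = (((gnomonic x : Euc (d + 1)) 0)⁻¹ ^ (d + 1) : ℝ) • g x := by
  have h : gnomonic x ∈ upperHalf d := gnomonic_zero_pos x
  rw [transplant, Set.indicator_of_mem h, gnomonicInv_gnomonic]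

/-- The weight built into the transplant is the Jacobian of the central projection, so pairings are
preserved exactly and the zonal operator transfers without an error term. -/
theorem integral_transplant_mul {g : Euc d → ℂ} (hg : Measurable g)
    {h : UnitSphere (d + 1) → ℂ} (hh : Measurable h) :
    ∫ ω, transplant g ω * h ω ∂sphereMeasure (d + 1) = ∫ x, g x * h (gnomonic x) := by
  have h1 := integral_gnomonic (h := fun ω => g (gnomonicInv (ω : Euc (d + 1))) * h ω)
    ((hg.comp (measurable_gnomonicInv.comp measurable_subtype_coe)).mul hh)
  simp only [gnomonicInv_gnomonic] at h1
  rw [h1, ← integral_indicator measurableSet_upperHalf]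
  congr 1
  ext ω
  by_cases hω : ω ∈ upperHalf d
  · rw [Set.indicator_of_mem hω, transplant, Set.indicator_of_mem hω, smul_mul_assoc]
  · rw [Set.indicator_of_notMem hω, transplant, Set.indicator_of_notMem hω, zero_mul]

theorem eLpNorm_transplant_le {g : Euc d → ℂ} (hg : Measurable g)
    (hsupp : ∀ x ∉ Metric.ball (0 : Euc d) 1, g x = 0) (p : ENNReal) :
    eLpNorm (transplant g) p (sphereMeasure (d + 1)) ≤
      ENNReal.ofReal (2 ^ (d + 1)) * eLpNorm g p volume := by
  have h1 : eLpNorm (transplant g) p (sphereMeasure (d + 1)) =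
      eLpNorm (transplant g) p ((sphereMeasure (d + 1)).restrict (upperHalf d)) := by
    rw [← eLpNorm_indicator_eq_eLpNorm_restrict measurableSet_upperHalf, transplant,
      Set.indicator_indicator, Set.inter_self]
  rw [h1]
  refine (eLpNorm_mono_measure _ restrict_upperHalf_le).trans ?_
  rw [eLpNorm_map_measure (measurable_transplant hg).aestronglyMeasurable
    continuous_gnomonic.aemeasurable]
  refine eLpNorm_le_mul_eLpNorm_of_ae_le_mul (Filter.Eventually.of_forall fun x => ?_) p
  rw [Function.comp_apply, transplant_gnomonic]
  by_cases hx : x ∈ Metric.ball (0 : Euc d) 1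
  · have h2 := inv_gnomonic_zero_le hx
    have h3 := inv_nonneg.2 (gnomonic_zero_pos x).le
    rw [norm_smul, Real.norm_of_nonneg (pow_nonneg h3 _)]
    gcongr
  · rw [hsupp x hx]; simp

theorem eLpNorm_gnomonic_le {G : UnitSphere (d + 1) → ℂ}
    (hG : AEStronglyMeasurable G (sphereMeasure (d + 1))) (q : ENNReal) :
    eLpNorm (G ∘ gnomonic) q ((volume : Measure (Euc d)).restrict (Metric.ball 0 1)) ≤
      (2 ^ (d + 1) : ENNReal) ^ (1 / q).toReal * eLpNorm G q (sphereMeasure (d + 1)) := by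
  have hac : Measure.map gnomonic ((volume : Measure (Euc d)).restrict (Metric.ball 0 1)) ≪
      sphereMeasure (d + 1) :=
    Measure.absolutelyContinuous_of_le_smul map_gnomonic_restrict_ball_le
  rw [← eLpNorm_map_measure (hG.mono_ac hac) continuous_gnomonic.aemeasurable]
  exact eLpNorm_le_of_measure_le_smul map_gnomonic_restrict_ball_le

/-- The exponent uses `(p⁻¹).toReal`, which is `0` for `p = ∞`, so that case fits the same formula.
-/
theorem eLpNorm_comp_smul {r : ℝ} (hr : 0 < r) (g : Euc d → ℂ) (p : ENNReal) :
    eLpNorm (fun x => g (r • x)) p volume =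
      ENNReal.ofReal r ^ (-(d : ℝ) * (p⁻¹).toReal) * eLpNorm g p volume := by
  have h := Measure.map_addHaar_smul (volume : Measure (Euc d)) hr.ne'
  rw [finrank_euclideanSpace_fin] at h
  have he : MeasurableEmbedding fun x : Euc d => r • x :=
    (Homeomorph.smulOfNeZero r hr.ne').measurableEmbedding
  have h1 := he.eLpNorm_map_measure (g := g) (p := p) (μ := volume)
  have hpos : (0 : ℝ) < (r ^ d)⁻¹ := by positivity
  rw [h, eLpNorm_smul_measure_of_ne_zero (by rw [ENNReal.ofReal_ne_zero_iff, abs_of_pos hpos]; exact hpos),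
    abs_of_pos hpos] at h1
  refine Eq.trans h1.symm ?_
  rw [smul_eq_mul, one_div]
  congr 1
  rw [ENNReal.rpow_mul, ENNReal.rpow_neg, ENNReal.rpow_natCast, ENNReal.ofReal_inv_of_pos (by positivity),
    ENNReal.ofReal_pow hr.le]

end transplant

/-! ### Bounds for zonal functions -/

section zonal

variable {d : ℕ} [NeZero d]

theorem measurable_zonal (n : ℕ) : Measurable (zonal d n) := by
  have h : Measurable (fun z : ℝ × UnitSphere d =>
      ((z.1 : ℂ) + Complex.I * (Real.sqrt (1 - z.1 ^ 2) : ℝ) *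
        ((z.2 : Euc d) 0 : ℝ)) ^ n) :=
    Continuous.measurable (by fun_prop)
  exact (h.stronglyMeasurable.integral_prod_right (ν := sphereMeasure d)).measurable

/-- The squared modulus of the base is `t² + (1 - t²) η₀² ≤ 1`. The bound is uniform in `n` and
serves as a majorant in the limits. -/
theorem norm_laplace_integrand_le {t : ℝ} (ht : t ^ 2 ≤ 1) (n : ℕ) (η : UnitSphere d) :
    ‖((t : ℂ) + Complex.I * (Real.sqrt (1 - t ^ 2) : ℝ) * ((η : Euc d) 0 : ℝ)) ^ n‖ ≤ 1 := by
  rw [norm_pow]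
  refine pow_le_one₀ (norm_nonneg _) ?_
  have h1 := PiLp.norm_apply_le (η : Euc d) 0
  rw [norm_eq_of_mem_sphere, Real.norm_eq_abs, ← sq_le_one_iff_abs_le_one] at h1
  have h2 : (t : ℂ) + Complex.I * (Real.sqrt (1 - t ^ 2) : ℝ) * ((η : Euc d) 0 : ℝ) =
      (t : ℂ) + ((Real.sqrt (1 - t ^ 2) * (η : Euc d) 0 : ℝ) : ℂ) * Complex.I := by
    push_cast; ring
  rw [h2, Complex.norm_add_mul_I]
  refine Real.sqrt_le_iff.2 ⟨zero_le_one, ?_⟩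
  rw [mul_pow, Real.sq_sqrt (by linarith)]
  nlinarith

theorem norm_zonal_le {t : ℝ} (ht : t ^ 2 ≤ 1) (n : ℕ) :
    ‖zonal d n t‖ ≤ (sphereMeasure d).real Set.univ := by
  unfold zonal laplaceMean
  refine (norm_integral_le_of_norm_le_const (C := 1)
    (Filter.Eventually.of_forall fun η => norm_laplace_integrand_le ht n η)).trans ?_
  rw [one_mul]

end zonal

/-! ### Mehler–Heine asymptotics -/

section limit

open Filter Topology

variable {d : ℕ}

theorem inner_gnomonic (a b : Euc d) :
    inner ℝ (gnomonic a : Euc (d + 1)) (gnomonic b : Euc (d + 1)) =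
      (1 + inner ℝ a b) / (‖consVec 1 a‖ * ‖consVec 1 b‖) := by
  simp only [gnomonic, inner_smul_left, inner_smul_right, inner_consVec, conj_trivial]
  field_simp

theorem inner_sphere_sq_le_one {m : ℕ} (x y : UnitSphere m) :
    (inner ℝ (x : Euc m) (y : Euc m)) ^ 2 ≤ 1 := by
  have h := abs_real_inner_le_norm (x : Euc m) (y : Euc m)
  rw [norm_eq_of_mem_sphere, norm_eq_of_mem_sphere, mul_one] at h
  rwa [sq_le_one_iff_abs_le_one]

/-- This is the exact squared sine of the angle. The Gram determinant is quartic, so under scaling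
by `1/n` it is negligible against `‖b - a‖²`. -/
theorem one_sub_inner_gnomonic_sq (a b : Euc d) :
    1 - (inner ℝ (gnomonic a : Euc (d + 1)) (gnomonic b : Euc (d + 1))) ^ 2 =
      (‖b - a‖ ^ 2 + (‖a‖ ^ 2 * ‖b‖ ^ 2 - (inner ℝ a b) ^ 2)) /
        ((1 + ‖a‖ ^ 2) * (1 + ‖b‖ ^ 2)) := by
  have ha : ‖consVec 1 a‖ ^ 2 = 1 + ‖a‖ ^ 2 := by rw [norm_consVec_sq, one_pow]
  have hb : ‖consVec 1 b‖ ^ 2 = 1 + ‖b‖ ^ 2 := by rw [norm_consVec_sq, one_pow]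
  rw [inner_gnomonic, div_pow, mul_pow, ha, hb, norm_sub_sq_real, real_inner_comm a b]
  have h1 : 0 < 1 + ‖a‖ ^ 2 := by positivity
  have h2 : 0 < 1 + ‖b‖ ^ 2 := by positivity
  field_simp
  ring

/-- The cosine of the angle between rescaled points. -/
noncomputable def scaledInner (n : ℕ) (x y : Euc d) : ℝ :=
  inner ℝ (gnomonic ((n : ℝ)⁻¹ • y) : Euc (d + 1)) (gnomonic ((n : ℝ)⁻¹ • x) : Euc (d + 1))

theorem tendsto_inv_smul (x : Euc d) :
    Tendsto (fun n : ℕ => (n : ℝ)⁻¹ • x) atTop (𝓝 0) := by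
  have h := (tendsto_inv_atTop_nhds_zero_nat (𝕜 := ℝ)).smul_const x
  rwa [zero_smul] at h

theorem tendsto_scaledInner (x y : Euc d) :
    Tendsto (fun n => scaledInner n x y) atTop (𝓝 1) := by
  have hg : ∀ z : Euc d, Tendsto (fun n : ℕ => (gnomonic ((n : ℝ)⁻¹ • z) : Euc (d + 1))) atTop
      (𝓝 (gnomonic (0 : Euc d) : Euc (d + 1))) := fun z =>
    ((continuous_subtype_val.comp continuous_gnomonic).tendsto 0).comp (tendsto_inv_smul z)
  have h := (hg y).inner (𝕜 := ℝ) (hg x)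
  rw [real_inner_self_eq_norm_sq, norm_eq_of_mem_sphere, one_pow] at h
  exact h

theorem tendsto_sq_mul_one_sub (x y : Euc d) :
    Tendsto (fun n : ℕ => (n : ℝ) ^ 2 * (1 - scaledInner n x y ^ 2)) atTop (𝓝 (‖x - y‖ ^ 2)) := by
  have hlim : Tendsto (fun n : ℕ =>
      (‖x - y‖ ^ 2 + (n : ℝ)⁻¹ ^ 2 * (‖y‖ ^ 2 * ‖x‖ ^ 2 - (inner ℝ y x) ^ 2)) /
        ((1 + ‖(n : ℝ)⁻¹ • y‖ ^ 2) * (1 + ‖(n : ℝ)⁻¹ • x‖ ^ 2))) atTop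
      (𝓝 ((‖x - y‖ ^ 2 + 0 ^ 2 * (‖y‖ ^ 2 * ‖x‖ ^ 2 - (inner ℝ y x) ^ 2)) /
        ((1 + ‖(0 : Euc d)‖ ^ 2) * (1 + ‖(0 : Euc d)‖ ^ 2)))) := by
    have h0 := tendsto_inv_atTop_nhds_zero_nat (𝕜 := ℝ)
    refine Tendsto.div ((tendsto_const_nhds).add ((h0.pow 2).mul_const _))
      ((((tendsto_inv_smul y).norm.pow 2).const_add 1).mul
        (((tendsto_inv_smul x).norm.pow 2).const_add 1)) (by simp)
  simp only [norm_zero, ne_eq, OfNat.ofNat_ne_zero, not_false_eq_true, zero_pow, zero_mul, add_zero,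
    mul_one, div_one] at hlim
  refine hlim.congr' ?_
  filter_upwards [eventually_gt_atTop 0] with n hn
  have hn' : (0 : ℝ) < n := by exact_mod_cast hn
  rw [scaledInner, one_sub_inner_gnomonic_sq, ← smul_sub, norm_smul _ (x - y), norm_smul _ y, norm_smul _ x,
    inner_smul_left, inner_smul_right, norm_inv, Real.norm_natCast, conj_trivial]
  field_simp

theorem tendsto_mul_sqrt (x y : Euc d) :
    Tendsto (fun n : ℕ => (n : ℝ) * Real.sqrt (1 - scaledInner n x y ^ 2)) atTop
      (𝓝 ‖x - y‖) := by
  have h := (tendsto_sq_mul_one_sub x y).sqrt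
  rw [Real.sqrt_sq (norm_nonneg _)] at h
  refine h.congr fun n => ?_
  rw [Real.sqrt_mul (sq_nonneg _), Real.sqrt_sq (Nat.cast_nonneg _)]

/-- With `s` the cosine, `1 - s = (1 - s²)/(1 + s)` is of order `n⁻²`, so one factor `n` does not
compensate it. -/
theorem tendsto_mul_sub_one (x y : Euc d) :
    Tendsto (fun n : ℕ => (n : ℝ) * (scaledInner n x y - 1)) atTop (𝓝 0) := by
  have h1 := ((tendsto_inv_atTop_nhds_zero_nat (𝕜 := ℝ)).mul (tendsto_sq_mul_one_sub x y)).div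
    ((tendsto_scaledInner x y).const_add 1) (by norm_num)
  have h2 := h1.neg
  simp only [zero_mul, zero_div, neg_zero] at h2
  refine h2.congr' ?_
  filter_upwards [eventually_gt_atTop 0,
    (tendsto_scaledInner x y).eventually (lt_mem_nhds (show (0 : ℝ) < 1 by norm_num))] with n hn ht
  have hn' : (0 : ℝ) < n := by exact_mod_cast hn
  have h3 : 1 + scaledInner n x y ≠ 0 := by positivity
  simp only [Pi.div_apply]
  field_simp
  ring

variable [NeZero d]

theorem integral_exp_coord (v : Euc d) :
    ∫ η : UnitSphere d, Complex.exp (Complex.I * (‖v‖ * ((η : Euc d) 0 : ℝ))) ∂sphereMeasure d =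
      ∫ η : UnitSphere d, Complex.exp (Complex.I * (inner ℝ v (η : Euc d) : ℝ))
        ∂sphereMeasure d := by
  obtain ⟨L, hL⟩ := exists_isometry_map_eq (v := EuclideanSpace.single (0 : Fin d) ‖v‖) (w := v)
    (by simp)
  rw [← integral_sphereIsometry L
    (fun η => Complex.exp (Complex.I * (inner ℝ v (η : Euc d) : ℝ)))]
  congr 1
  ext η
  have h : inner ℝ v (L (η : Euc d)) = ‖v‖ * (η : Euc d) 0 := by
    conv_lhs => rw [← hL]
    rw [L.inner_map_map]
    simp [EuclideanSpace.inner_single_left, mul_comm]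
  rw [coe_sphereIsometry, h]
  push_cast
  rfl

/-- A Mehler–Heine formula for zonal functions. -/
theorem tendsto_zonal_scaledInner (x y : Euc d) :
    Tendsto (fun n : ℕ => zonal d n (scaledInner n x y)) atTop
      (𝓝 (∫ η : UnitSphere d, Complex.exp (Complex.I * (inner ℝ (x - y) (η : Euc d) : ℝ))
        ∂sphereMeasure d)) := by
  rw [← integral_exp_coord]
  unfold zonal laplaceMean
  refine tendsto_integral_of_dominated_convergence (fun _ => 1) (fun n => ?_)
    (integrable_const _) (fun n => Eventually.of_forall fun η =>
      norm_laplace_integrand_le (inner_sphere_sq_le_one _ _) n η)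
    (Eventually.of_forall fun η => ?_)
  · exact Continuous.aestronglyMeasurable (by fun_prop)
  -- The base of the power is `1 + w_n/n` with `w_n → i ‖x - y‖ η₀`, so its `n`-th power tends to
  -- the exponential.
  · have h1 : Tendsto (fun n : ℕ => (n : ℂ) * (((scaledInner n x y : ℝ) : ℂ) - 1 +
        Complex.I * (Real.sqrt (1 - scaledInner n x y ^ 2) : ℝ) * ((η : Euc d) 0 : ℝ))) atTop
        (𝓝 (((0 : ℝ) : ℂ) + Complex.I * (((‖x - y‖ : ℝ) : ℂ) * ((η : Euc d) 0 : ℝ)))) := by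
      have h2 := (Complex.continuous_ofReal.tendsto _).comp (tendsto_mul_sub_one x y)
      have h3 := (((Complex.continuous_ofReal.tendsto _).comp (tendsto_mul_sqrt x y)).mul_const
        (((η : Euc d) 0 : ℝ) : ℂ)).const_mul Complex.I
      refine (h2.add h3).congr fun n => ?_
      simp only [Function.comp_apply]
      push_cast
      ring
    rw [Complex.ofReal_zero, zero_add] at h1
    have h4 := Complex.tendsto_one_add_pow_exp_of_tendsto h1
    refine h4.congr fun n => ?_
    congr 1
    ring

end limit

/-! ### The extension operator as a convolution -/

section extension

variable {d : ℕ}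

/-- The extension operator as a convolution operator. -/
theorem sphereExtension_eq {f : Euc d → ℂ} (hf : Integrable f) (x : Euc d) :
    sphereExtension f x = ∫ y, f y * ∫ η : UnitSphere d,
      Complex.exp (Complex.I * (inner ℝ (x - y) (η : Euc d) : ℝ)) ∂sphereMeasure d := by
  have hexp : ∀ (y : Euc d) (η : UnitSphere d),
      Complex.exp (Complex.I * (inner ℝ x (η : Euc d) : ℝ)) *
        (Complex.exp (-Complex.I * (inner ℝ y (η : Euc d) : ℝ)) * f y) =
      f y * Complex.exp (Complex.I * (inner ℝ (x - y) (η : Euc d) : ℝ)) := by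
    intro y η
    rw [← mul_assoc, ← Complex.exp_add, inner_sub_left, mul_comm]
    congr 2
    push_cast
    ring
  unfold sphereExtension fourierHat
  simp only [← integral_const_mul, hexp]
  refine integral_integral_swap ?_
  have h1 : Integrable (fun z : UnitSphere d × Euc d => f z.2)
      ((sphereMeasure d).prod volume) := hf.comp_snd _
  refine h1.mul_bdd (c := 1) ?_ (Filter.Eventually.of_forall fun z => ?_)
  · exact Continuous.aestronglyMeasurable (by fun_prop)
  · rw [mul_comm, Complex.norm_exp_ofReal_mul_I]

end extension

/-! ### Rescaling, uniform bounds and passage to the limit -/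

section main

open Filter Topology

variable {d : ℕ}

/-- The rescaling of a function to the unit ball. -/
noncomputable def rescale (n : ℕ) (f : Euc d → ℂ) : Euc d → ℂ :=
  (Metric.ball 0 1).indicator fun y => f ((n : ℝ) • y)

theorem smul_mem_ball_iff {n : ℕ} (hn : 0 < n) (x : Euc d) :
    (n : ℝ) • x ∈ Metric.ball (0 : Euc d) (n : ℝ) ↔ x ∈ Metric.ball (0 : Euc d) 1 := by
  have hn' : (0 : ℝ) < n := by exact_mod_cast hn
  rw [mem_ball_zero_iff, mem_ball_zero_iff, norm_smul, Real.norm_natCast,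
    mul_lt_iff_lt_one_right hn']

theorem continuous_scaledInner (n : ℕ) :
    Continuous fun z : Euc d × Euc d => scaledInner n z.1 z.2 := by
  have h1 : Continuous fun z : Euc d × Euc d => (gnomonic ((n : ℝ)⁻¹ • z.2) : Euc (d + 1)) :=
    continuous_subtype_val.comp
    (continuous_gnomonic.comp (show Continuous fun z : Euc d × Euc d => (n : ℝ)⁻¹ • z.2 by fun_prop))
  have h2 : Continuous fun z : Euc d × Euc d => (gnomonic ((n : ℝ)⁻¹ • z.1) : Euc (d + 1)) :=
    continuous_subtype_val.comp
    (continuous_gnomonic.comp (show Continuous fun z : Euc d × Euc d => (n : ℝ)⁻¹ • z.1 by fun_prop))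
  exact Continuous.inner (𝕜 := ℝ) h1 h2

variable [NeZero d]

/-- The rescaled zonal operator, localized to balls of radius `n`. -/
noncomputable def scaledProj (n : ℕ) (f : Euc d → ℂ) : Euc d → ℂ :=
  (Metric.ball 0 (n : ℝ)).indicator fun x =>
    ∫ y, (Metric.ball 0 (n : ℝ)).indicator f y * zonal d n (scaledInner n x y)

theorem measurable_scaledProj (n : ℕ) {f : Euc d → ℂ} (hf : Measurable f) :
    Measurable (scaledProj n f) := by
  refine Measurable.indicator ?_ measurableSet_ball
  have h1 : Measurable (fun z : Euc d × Euc d =>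
      (Metric.ball 0 (n : ℝ)).indicator f z.2 * zonal d n (scaledInner n z.1 z.2)) := by
    refine ((hf.indicator measurableSet_ball).comp measurable_snd).mul
      ((measurable_zonal n).comp (Continuous.measurable ?_))
    exact continuous_scaledInner n
  exact (h1.stronglyMeasurable.integral_prod_right (ν := (volume : Measure (Euc d)))).measurable

theorem integral_rescale_mul_zonal {n : ℕ} (hn : 0 < n) (f : Euc d → ℂ) (x : Euc d)
    (hx : x ∈ Metric.ball (0 : Euc d) 1) :
    ∫ y, rescale n f y *
      zonal d n (inner ℝ (gnomonic y : Euc (d + 1)) (gnomonic x : Euc (d + 1))) =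
      ((((n : ℝ) ^ d)⁻¹ : ℝ) : ℂ) * scaledProj n f ((n : ℝ) • x) := by
  have hn' : (0 : ℝ) < n := by exact_mod_cast hn
  have h := Measure.integral_comp_smul (volume : Measure (Euc d))
    (fun y => (Metric.ball 0 (n : ℝ)).indicator f y *
      zonal d n (scaledInner n ((n : ℝ) • x) y)) (n : ℝ)
  rw [finrank_euclideanSpace_fin, abs_of_pos (by positivity), Complex.real_smul] at h
  rw [scaledProj, Set.indicator_of_mem ((smul_mem_ball_iff hn x).2 hx), ← h]
  congr 1
  ext y
  rw [scaledInner, inv_smul_smul₀ hn'.ne', inv_smul_smul₀ hn'.ne', rescale]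
  congr 1
  by_cases hy : y ∈ Metric.ball (0 : Euc d) 1
  · rw [Set.indicator_of_mem hy, Set.indicator_of_mem ((smul_mem_ball_iff hn y).2 hy)]
  · rw [Set.indicator_of_notMem hy,
      Set.indicator_of_notMem fun h => hy ((smul_mem_ball_iff hn y).1 h)]

/-- Transplantation inequality: the norm of the rescaled zonal operator is controlled by the norm
of the projection to the spherical harmonics. -/
theorem eLpNorm_scaledProj_le {n : ℕ} (hn : 0 < n) {p q : ENNReal} (hp : 1 ≤ p)
    {f : Euc d → ℂ} (hf : Measurable f) (hfp : MemLp f p volume) :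
    ‖kernelDiag d n / ((sphereMeasure d).real Set.univ : ℂ) * ((((n : ℝ) ^ d)⁻¹ : ℝ) : ℂ)‖ₑ *
      ((n : ENNReal) ^ (-(d : ℝ) * (q⁻¹).toReal) * eLpNorm (scaledProj n f) q volume) ≤
    (2 ^ (d + 1) : ENNReal) ^ (1 / q).toReal * (projNorm d n p q *
      (ENNReal.ofReal (2 ^ (d + 1)) *
        ((n : ENNReal) ^ (-(d : ℝ) * (p⁻¹).toReal) * eLpNorm f p volume))) := by
  have hn' : (0 : ℝ) < n := by exact_mod_cast hn
  set κ : ℂ := kernelDiag d n / ((sphereMeasure d).real Set.univ : ℂ)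
  set g := rescale n f with hg
  have hgm : Measurable g := (hf.comp (measurable_const_smul _)).indicator measurableSet_ball
  have hgs : ∀ x ∉ Metric.ball (0 : Euc d) 1, g x = 0 := fun x hx => Set.indicator_of_notMem hx _
  have hg_le : eLpNorm g p volume ≤
      (n : ENNReal) ^ (-(d : ℝ) * (p⁻¹).toReal) * eLpNorm f p volume := by
    refine (eLpNorm_indicator_le _).trans ?_
    rw [eLpNorm_comp_smul hn', ENNReal.ofReal_natCast]
  have hF_le := (eLpNorm_transplant_le hgm hgs p).trans (mul_le_mul_right hg_le _)
  have hF : MemLp (transplant g) p (sphereMeasure (d + 1)) := by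
    refine ⟨(measurable_transplant hgm).aestronglyMeasurable, hF_le.trans_lt ?_⟩
    refine ENNReal.mul_lt_top ENNReal.ofReal_lt_top (ENNReal.mul_lt_top ?_ hfp.2)
    exact (ENNReal.rpow_ne_top_of_ne_zero (by exact_mod_cast hn.ne')
      (ENNReal.natCast_ne_top n)).lt_top
  have hae := harmonicProj_ae_eq_zonal (d := d) (n := n) (hF.integrable hp)
  -- The projection is only an almost-everywhere class; `H` is an explicit representative that can
  -- be evaluated along the central projection.
  set H : UnitSphere (d + 1) → ℂ := fun x => κ *
    ∫ y : UnitSphere (d + 1), transplant g y *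
      zonal d n (inner ℝ (y : Euc (d + 1)) (x : Euc (d + 1))) ∂sphereMeasure (d + 1)
  have hHm : AEStronglyMeasurable H (sphereMeasure (d + 1)) :=
    (Lp.aestronglyMeasurable _).congr hae
  have hH : ∀ x ∈ Metric.ball (0 : Euc d) 1, H (gnomonic x) =
      (κ * ((((n : ℝ) ^ d)⁻¹ : ℝ) : ℂ)) * scaledProj n f ((n : ℝ) • x) := by
    intro x hx
    have hz : Measurable fun y : UnitSphere (d + 1) =>
        zonal d n (inner ℝ (y : Euc (d + 1)) (gnomonic x : Euc (d + 1))) :=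
      (measurable_zonal n).comp (Continuous.measurable (by fun_prop))
    rw [mul_assoc, ← integral_rescale_mul_zonal hn f x hx]
    exact congrArg (κ * ·) (integral_transplant_mul hgm hz)
  have h1 : eLpNorm (H ∘ gnomonic) q ((volume : Measure (Euc d)).restrict (Metric.ball 0 1)) =
      ‖κ * ((((n : ℝ) ^ d)⁻¹ : ℝ) : ℂ)‖ₑ *
        ((n : ENNReal) ^ (-(d : ℝ) * (q⁻¹).toReal) * eLpNorm (scaledProj n f) q volume) := by
    rw [← eLpNorm_indicator_eq_eLpNorm_restrict measurableSet_ball, ← ENNReal.ofReal_natCast n,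
      ← eLpNorm_comp_smul hn', ← eLpNorm_const_smul]
    congr 1
    ext x
    by_cases hx : x ∈ Metric.ball (0 : Euc d) 1
    · rw [Set.indicator_of_mem hx, Function.comp_apply, hH x hx]
      rfl
    · rw [Set.indicator_of_notMem hx, Pi.smul_apply, scaledProj,
        Set.indicator_of_notMem fun h => hx ((smul_mem_ball_iff hn x).1 h), smul_zero]
  rw [← h1]
  refine (eLpNorm_gnomonic_le hHm q).trans (mul_le_mul_right ?_ _)
  rw [← eLpNorm_congr_ae hae]
  exact (eLpNorm_harmonicProj_le (zero_lt_one.trans_le hp).ne' hF).trans (mul_le_mul_right hF_le _)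

/-- Uniform bounds for the rescaled zonal operators. -/
theorem exists_eLpNorm_scaledProj_le (d : ℕ) [NeZero d] {p : ENNReal} (q : ENNReal) (hp : 1 ≤ p) :
    ∃ C : NNReal, ∀ B : NNReal,
      (∀ n : ℕ, 1 ≤ n → projNorm d n p q ≤
        (B : ENNReal) * (n : ENNReal) ^ ((d : ℝ) * ((p⁻¹).toReal - (q⁻¹).toReal) - 1)) →
      ∀ f : Euc d → ℂ, Measurable f → MemLp f p volume → ∀ n : ℕ, 2 ≤ n →
        eLpNorm (scaledProj n f) q volume ≤
          (C : ENNReal) * (B : ENNReal) * eLpNorm f p volume := by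
  obtain ⟨c, hc, hκ⟩ := exists_le_norm_kernelDiag d
  set A : ENNReal := (2 ^ (d + 1) : ENNReal) ^ (1 / q).toReal
  have hA : A ≠ ⊤ := ENNReal.rpow_ne_top_of_nonneg ENNReal.toReal_nonneg
    (ENNReal.pow_ne_top ENNReal.ofNat_ne_top)
  set A' : ENNReal := ENNReal.ofReal (2 ^ (d + 1))
  have hc0 : ENNReal.ofReal c ≠ 0 := by rwa [ENNReal.ofReal_ne_zero_iff]
  have hC : (ENNReal.ofReal c)⁻¹ * A * A' ≠ ⊤ :=
    ENNReal.mul_ne_top (ENNReal.mul_ne_top (ENNReal.inv_ne_top.2 hc0) hA) ENNReal.ofReal_ne_top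
  refine ⟨((ENNReal.ofReal c)⁻¹ * A * A').toNNReal, fun B hB f hf hfp n hn => ?_⟩
  rw [ENNReal.coe_toNNReal hC]
  have hn0 : 0 < n := by omega
  have hn' : (0 : ℝ) < n := by exact_mod_cast hn0
  have hN0 : (n : ENNReal) ≠ 0 := by exact_mod_cast hn0.ne'
  have hNt : (n : ENNReal) ≠ ⊤ := ENNReal.natCast_ne_top n
  have h1 := eLpNorm_scaledProj_le hn0 (q := q) hp hf hfp
  set N : ENNReal := (n : ENNReal)
  -- This is the power of `n` common to both sides: `-d/q` and the kernel's `-1` on the left, `d(1/p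
  -- - 1/q) - 1` and `-d/p` on the right. It is finite and nonzero, hence cancels.
  set P : ENNReal := N ^ (-(d : ℝ) * (q⁻¹).toReal - 1) with hP
  have hP0 : P ≠ 0 := (ENNReal.rpow_pos (pos_iff_ne_zero.2 hN0) hNt).ne'
  have hPt : P ≠ ⊤ := ENNReal.rpow_ne_top_of_ne_zero hN0 hNt
  have h2 : ENNReal.ofReal c * N ^ (-1 : ℝ) ≤
      ‖kernelDiag d n / ((sphereMeasure d).real Set.univ : ℂ) * ((((n : ℝ) ^ d)⁻¹ : ℝ) : ℂ)‖ₑ := by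
    have h3 : N ^ (-1 : ℝ) = ENNReal.ofReal (n : ℝ)⁻¹ := by
      rw [ENNReal.rpow_neg_one, ENNReal.ofReal_inv_of_pos hn', ENNReal.ofReal_natCast]
    rw [h3, ← ENNReal.ofReal_mul hc.le, ← ofReal_norm, norm_mul, Complex.norm_real,
      Real.norm_of_nonneg (by positivity)]
    refine ENNReal.ofReal_le_ofReal ?_
    calc c * (n : ℝ)⁻¹ = c * (n : ℝ) ^ (d - 1) * ((n : ℝ) ^ d)⁻¹ := by
          obtain ⟨k, hk⟩ : ∃ k, d = k + 1 := ⟨d - 1, (Nat.succ_pred_eq_of_ne_zero (NeZero.ne d)).symm⟩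
          rw [hk, Nat.add_sub_cancel, pow_succ]
          field_simp
      _ ≤ _ := mul_le_mul_of_nonneg_right (hκ n hn) (by positivity)
  have h4 : P * (ENNReal.ofReal c * eLpNorm (scaledProj n f) q volume) ≤
      P * (A * A' * B * eLpNorm f p volume) := by
    calc P * (ENNReal.ofReal c * eLpNorm (scaledProj n f) q volume)
        = ENNReal.ofReal c * N ^ (-1 : ℝ) *
          (N ^ (-(d : ℝ) * (q⁻¹).toReal) * eLpNorm (scaledProj n f) q volume) := by
          rw [hP, sub_eq_add_neg, ENNReal.rpow_add _ _ hN0 hNt]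
          ring
      _ ≤ _ := mul_le_mul_left h2 _
      _ ≤ _ := h1
      _ ≤ A * ((B * N ^ ((d : ℝ) * ((p⁻¹).toReal - (q⁻¹).toReal) - 1)) *
          (A' * (N ^ (-(d : ℝ) * (p⁻¹).toReal) * eLpNorm f p volume))) := by
        gcongr
        exact hB n (by omega)
      _ = P * (A * A' * B * eLpNorm f p volume) := by
        have h5 : P = N ^ ((d : ℝ) * ((p⁻¹).toReal - (q⁻¹).toReal) - 1) *
            N ^ (-(d : ℝ) * (p⁻¹).toReal) := by
          rw [← ENNReal.rpow_add _ _ hN0 hNt, hP]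
          congr 1
          ring
        rw [h5]
        ring
  have h5 := (ENNReal.mul_le_mul_iff_right hP0 hPt).1 h4
  calc eLpNorm (scaledProj n f) q volume
      = (ENNReal.ofReal c)⁻¹ * (ENNReal.ofReal c * eLpNorm (scaledProj n f) q volume) := by
        rw [← mul_assoc, ENNReal.inv_mul_cancel hc0 ENNReal.ofReal_ne_top, one_mul]
    _ ≤ (ENNReal.ofReal c)⁻¹ * (A * A' * B * eLpNorm f p volume) := mul_le_mul_right h5 _
    _ = _ := by ring

/-- The rescaled zonal operators converge to the extension operator. -/
theorem tendsto_scaledProj {f : Euc d → ℂ} (hf : Measurable f) (hfi : Integrable f) (x : Euc d) :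
    Tendsto (fun n : ℕ => scaledProj n f x) atTop (𝓝 (sphereExtension f x)) := by
  have hball : ∀ y : Euc d, ∀ᶠ n : ℕ in atTop, y ∈ Metric.ball (0 : Euc d) (n : ℝ) := by
    intro y
    filter_upwards [tendsto_natCast_atTop_atTop.eventually_gt_atTop ‖y‖] with n hn
    simpa using hn
  have h1 : Tendsto (fun n : ℕ => ∫ y, (Metric.ball 0 (n : ℝ)).indicator f y *
      zonal d n (scaledInner n x y)) atTop (𝓝 (sphereExtension f x)) := by
    rw [sphereExtension_eq hfi]
    refine tendsto_integral_of_dominated_convergence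
      (fun y => ‖f y‖ * (sphereMeasure d).real Set.univ) (fun n => ?_)
      (hfi.norm.mul_const _) (fun n => Eventually.of_forall fun y => ?_)
      (Eventually.of_forall fun y => ?_)
    · have hc : Measurable fun y : Euc d => scaledInner n x y :=
        ((continuous_scaledInner n).comp
          (show Continuous fun y : Euc d => (x, y) by fun_prop)).measurable
      have hz : Measurable fun y : Euc d => zonal d n (scaledInner n x y) :=
        (measurable_zonal n).comp hc
      exact ((hf.indicator measurableSet_ball).mul hz).aestronglyMeasurable
    · rw [norm_mul]
      exact mul_le_mul (norm_indicator_le_norm_self _ _)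
        (norm_zonal_le (inner_sphere_sq_le_one _ _) n) (norm_nonneg _) (norm_nonneg _)
    -- For fixed `y` the cutoff to the ball of radius `n` is eventually invisible, leaving the
    -- pointwise limit of the kernel.
    · refine Tendsto.congr' ?_ ((tendsto_zonal_scaledInner x y).const_mul (f y))
      filter_upwards [hball y] with n hn
      rw [Set.indicator_of_mem hn]
  refine h1.congr' ?_
  filter_upwards [hball x] with n hn
  rw [scaledProj, Set.indicator_of_mem hn]

end main

end SphericalProjection

theorem lemma4p2 (d : ℕ) (hd : 1 ≤ d) (p q : ENNReal) (hp : 1 ≤ p) (hq : 1 ≤ q) :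
    ∃ C : NNReal, ∀ B : NNReal,
      (∀ n : ℕ, 1 ≤ n →
        SphericalProjection.projNorm d n p q ≤
          (B : ENNReal) * (n : ENNReal) ^ ((d : ℝ) * ((p⁻¹).toReal - (q⁻¹).toReal) - 1)) →
      ∀ f : SchwartzMap (EuclideanSpace ℝ (Fin d)) ℂ,
        eLpNorm (SphericalProjection.sphereExtension (f : EuclideanSpace ℝ (Fin d) → ℂ)) q volume ≤
          (C : ENNReal) * (B : ENNReal) * eLpNorm f p volume := by
  have : NeZero d := ⟨by omega⟩
  obtain ⟨C, hC⟩ := SphericalProjection.exists_eLpNorm_scaledProj_le d q hp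
  refine ⟨C, fun B hB f => ?_⟩
  have hfm : Measurable f := f.continuous.measurable
  -- Fatou's lemma, valid for `q = ∞` as well, so pointwise convergence and the uniform bound
  -- suffice.
  refine (Lp.eLpNorm_lim_le_liminf_eLpNorm
    (fun n => (SphericalProjection.measurable_scaledProj n hfm).aestronglyMeasurable) _
    (Filter.Eventually.of_forall fun x =>
      SphericalProjection.tendsto_scaledProj hfm f.integrable x)).trans ?_
  refine Filter.liminf_le_of_frequently_le' (Filter.Eventually.frequently ?_)
  -- The dimension count behind the uniform bound starts at `n = 2`; only large `n` matter for the
  -- lower limit.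
  filter_upwards [Filter.eventually_ge_atTop 2] with n hn
  exact hC B hB f hfm (f.memLp p) n hn
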